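/- Setting. Let $f:[0,\infty)\to[0,\infty]$ be convex with $f(1)=f'(1)=0$, where $f'$ denotes the maximal subgradient (right derivative), and let $(f')^{-1}(u)=\inf\{t>0: f'(t)\ge u\}$ (with $\inf\emptyset=\infty$). For probability measures $\nu,\mu$ on a measurable space $\mathcal X$ let $D_f(\nu\|\mu)=\int f(\frac{d\nu}{d\mu})\,d\mu+f'(\infty)\,\nu_{\mathrm{sing}}(\mathcal X)$, where $\nu_{\mathrm{sing}}$ is the part of $\nu$ singular to $\mu$; $\nu$ is $(f,\sigma)$-smooth with respect to $\mu$ if $D_f(\nu\|\mu)\le 1/\sigma$. In each round $t=1,\dots,T$ an adaptive adversary draws a context $x_t\in\mathcal X$ and a label $y_t\in[-1,1]$ given the history; the learner sees $x_t$ (improper learning), predicts $\widehat y_t\in[-1,1]$, possibly at random, and then sees $y_t$. The adversary is $(f,\sigma)$-smooth if the law of $x_t$ given the history is $(f,\sigma)$-smooth with respect to $\mu$ for every $t\le T$. The loss $\ell:[-1,1]\times[-1,1]\to[0,1]$ is convex and $1$-Lipschitz in its first argument, and for a class $\mathcal F$ of functions on $\mathcal X$ the regret is $\mathrm{Reg}_T=\sum_{t=1}^T\ell(\widehat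 y_t,y_t)-\inf_{g\in\mathcal F}\sum_{t=1}^T\ell(g(x_t),y_t)$. The learner has access to $\mathcal F$ only through an exact ERM oracle, which, given points $x_i\in\mathcal X$, labels $y_i\in[-1,1]$, real weights $w_i$ and $[0,1]$-valued losses $\ell_i$ (continuous in the prediction), $1\le i\le m$, returns some $\widehat g\in\mathcal F$ minimizing $\sum_i w_i\ell_i(g(x_i),y_i)$ over $g\in\mathcal F$; its randomness consists, in each round, of $Tn$ independent samples from $\mu$ and $Tn$ fair coins, for some $n\in\mathbb N$. Theorem. (1) There is a universal constant $C$ such that, for all $T\ge2$, $\sigma>0$, $d\in\mathbb N$, there are an $n$ and an improper algorithm making 2 calls to the ERM oracle per round such that, for every $\mathcal F\subset\{\pm1\}^{\mathcal X}$ of VC dimension $d$ and every $(f,\sigma)$-smooth adversary, $$\mathbb E[\mathrm{Reg}_T]\le C\inf_{\alpha>0}\left\{\alpha T+\sqrt{d\,T\log(T)\,(f')^{-1}\left(\tfrac1{\alpha\sigma}\right)}\right\}.$$ (2) For all $T,n\in\mathbb N$ there is an improper algorithm making 2 calls to the ERM oracle per round such that, for every class $\mathcal F$ of functions $\mathcal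 X\to[-1,1]$, all $\sigma,\epsilon>0$ with $n\ge 8\log(T)\,(f')^{-1}\left(\tfrac1{\epsilon\sigma}\right)$, and every $(f,\sigma)$-smooth adversary, $$\mathbb E[\mathrm{Reg}_T]\le 2\,\mathbb E_\mu[\mathfrak R_{nT}(\mathcal F)]+\epsilon T+1,$$ where $\mathfrak R_N(\mathcal F)=\mathbb E_\varepsilon\left[\sup_{g\in\mathcal F}\sum_{i=1}^N\varepsilon_i g(Z_i)\right]$ with independent Rademacher signs $\varepsilon_i$, and $\mathbb E_\mu$ averages over independent $Z_1,\dots,Z_N\sim\mu$. -/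

import Mathlib

open MeasureTheory ProbabilityTheory
open scoped NNReal ENNReal

namespace SmoothedOnline

/-! ### Divergences -/

section Divergence

/-- The derivative of a convex function `f : [0, ∞) → [0, ∞]`, with the maximal subgradient (that is,
the right derivative, the infimum of the slopes to the right) where `f` is not differentiable. Outside
the domain of finiteness of `f`, which is an interval around `1`, it is `-∞` on the left of that
interval and `+∞` on the right. -/
noncomputable def maxSubgradient (f : ℝ≥0 → ℝ≥0∞) (t : ℝ≥0) : EReal :=
  if f t = ⊤ then (if t < 1 then ⊥ else ⊤)
  else ⨅ s : ℝ≥0, ⨅ _ : t < s, ((f s : EReal) - (f t : EReal)) / (((s : ℝ) - (t : ℝ) : ℝ) : EReal)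

/-- `f` generates an `f`-divergence: it is convex with values in `[0, ∞]` and `f 1 = f' 1 = 0`. -/
structure IsGenerator (f : ℝ≥0 → ℝ≥0∞) : Prop where
  convex : ConvexOn ℝ≥0 Set.univ f
  map_one : f 1 = 0
  deriv_one : maxSubgradient f 1 = 0

/-- `f'(∞)`, the limit (supremum) of the nondecreasing function `f'`. -/
noncomputable def slopeAtTop (f : ℝ≥0 → ℝ≥0∞) : ℝ≥0∞ :=
  (⨆ t : ℝ≥0, maxSubgradient f t).toENNReal

/-- `(f')⁻¹(u) = inf {t > 0 | f'(t) ≥ u}`, which is `∞` if there is no such `t`. -/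
noncomputable def derivInv (f : ℝ≥0 → ℝ≥0∞) (u : ℝ) : ℝ≥0∞ :=
  ⨅ t : ℝ≥0, ⨅ _ : 0 < t ∧ (u : EReal) ≤ maxSubgradient f t, (t : ℝ≥0∞)

variable {X : Type*} [MeasurableSpace X]

/-- The `f`-divergence `D_f(ν ‖ μ)`: the integral of `f (dν/dμ)` against `μ`, plus `f'(∞)` times the
mass of the part of `ν` that is singular with respect to `μ` (where `dν/dμ = ∞`). -/
noncomputable def fDivergence (f : ℝ≥0 → ℝ≥0∞) (ν μ : Measure X) : ℝ≥0∞ :=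
  ∫⁻ z, f (ν.rnDeriv μ z).toNNReal ∂μ + slopeAtTop f * ν.singularPart μ Set.univ

/-- `ν` is `(f, σ)`-smooth with respect to `μ`. -/
def IsSmooth (f : ℝ≥0 → ℝ≥0∞) (σ : ℝ) (ν μ : Measure X) : Prop :=
  fDivergence f ν μ ≤ ENNReal.ofReal (1 / σ)

end Divergence

/-! ### Function classes and losses -/

/-- Labels and predictions live in `[-1, 1]`. -/
abbrev Pred : Type := Set.Icc (-1 : ℝ) 1

section FunctionClass

variable {X : Type*}

/-- Every function in the class takes values in `{-1, 1}`. -/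
def IsBinary (F : Set (X → Pred)) : Prop :=
  ∀ g ∈ F, ∀ x, (g x : ℝ) = 1 ∨ (g x : ℝ) = -1

/-- A binary class shatters the finite set `A`: every sign pattern on `A` is realized. -/
def Shatters (F : Set (X → Pred)) (A : Finset X) : Prop :=
  ∀ B : Set X, ∃ g ∈ F, ∀ x ∈ A, (g x : ℝ) = 1 ↔ x ∈ B

/-- The Vapnik-Chervonenkis dimension of a binary class. -/
noncomputable def vcDim (F : Set (X → Pred)) : ℕ∞ :=
  ⨆ A : Finset X, ⨆ _ : Shatters F A, (A.card : ℕ∞)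

/-- The usual measurability convention for uncountable classes: for every `m` and every open set `U` it
is a measurable event in `x : X ^ m` that `(g x₁, …, g xₘ)` lies in `U` for some `g` in the class. (This
makes suprema over the class of continuous functions of finitely many values measurable.) -/
def HasMeasurableTraces [MeasurableSpace X] (F : Set (X → Pred)) : Prop :=
  ∀ (m : ℕ) (U : Set (Fin m → Pred)), IsOpen U →
    MeasurableSet {x : Fin m → X | ∃ g ∈ F, (fun i => g (x i)) ∈ U}

/-- The sign `±1` encoded by a fair coin. -/
def sign (b : Bool) : ℝ := if b then 1 else -1

/-- The Rademacher complexity `E_ε sup_{g ∈ F} ∑ᵢ εᵢ g(zᵢ)` at the points `z₁, …, z_N`. -/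
noncomputable def rademacher (F : Set (X → Pred)) {N : ℕ} (z : Fin N → X) : ℝ :=
  (∑ ε : Fin N → Bool, ⨆ g : F, ∑ i, sign (ε i) * ((g : X → Pred) (z i) : ℝ)) / 2 ^ N

/-- The Rademacher complexity averaged over `N` independent points with law `μ`. -/
noncomputable def expectedRademacher [MeasurableSpace X] (F : Set (X → Pred)) (μ : Measure X)
    (N : ℕ) : ℝ :=
  ∫ z : Fin N → X, rademacher F z ∂(Measure.pi fun _ => μ)

end FunctionClass

/-- A (measurable) loss `[-1, 1] × [-1, 1] → [0, 1]`, convex and `1`-Lipschitz in its first argument;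
only the values on `[-1, 1] × [-1, 1]` matter. -/
structure IsConvexLipschitzLoss (loss : ℝ → ℝ → ℝ) : Prop where
  mem_Icc : ∀ a ∈ Set.Icc (-1 : ℝ) 1, ∀ y ∈ Set.Icc (-1 : ℝ) 1, loss a y ∈ Set.Icc (0 : ℝ) 1
  convex : ∀ y ∈ Set.Icc (-1 : ℝ) 1, ConvexOn ℝ (Set.Icc (-1) 1) fun a => loss a y
  lipschitz : ∀ y ∈ Set.Icc (-1 : ℝ) 1, LipschitzOnWith 1 (fun a => loss a y) (Set.Icc (-1) 1)
  measurable : Measurable fun p : Pred × Pred => loss p.1 p.2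

/-! ### Empirical risk minimization oracles -/

section Oracle

variable {X : Type*}

/-- An input of the oracle: finitely many labelled points with real weights (of any sign) and
`[0, 1]`-valued losses. The losses are continuous in the prediction, so that a class with compact traces
has exact minimizers. -/
structure ERMQuery (X : Type*) where
  size : ℕ
  point : Fin size → X
  label : Fin size → Pred
  weight : Fin size → ℝ
  loss : Fin size → Pred → Pred → ℝ
  loss_mem : ∀ i a y, loss i a y ∈ Set.Icc (0 : ℝ) 1
  loss_continuous : ∀ i y, Continuous fun a => loss i a y

/-- The weighted cumulative loss of `g` on the data of the query. -/
noncomputable def ERMQuery.risk (q : ERMQuery X) (g : X → Pred) : ℝ :=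
  ∑ i, q.weight i * q.loss i (g (q.point i)) (q.label i)

/-- `oracle` answers every query with an exact minimizer over `F` of the weighted cumulative loss. -/
def IsERMOracle (F : Set (X → Pred)) (oracle : ERMQuery X → X → Pred) : Prop :=
  ∀ q, oracle q ∈ F ∧ ∀ g ∈ F, q.risk (oracle q) ≤ q.risk g

end Oracle

/-! ### The game -/

section Game

/-- What has been observed in the first `t` rounds: context, label and prediction of each round. -/
abbrev History (X : Type*) (t : ℕ) : Type _ := Fin t → X × Pred × Pred

/-- A randomized improper learner that makes `k` oracle calls per round. In the round after the first
`t` rounds, having seen the history, the new context and a fresh random seed, it chooses its queries one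
after the other, each in view of the answers to the previous ones in this round, and predicts once it
has `k` answers. -/
structure ImproperLearner (X : Type*) (S : Type*) (k : ℕ) where
  query : (t : ℕ) → History X t → X → S → List (X → Pred) → ERMQuery X
  predict : (t : ℕ) → History X t → X → S → List (X → Pred) → Pred

variable {X S : Type*} {k : ℕ}

/-- The answers to the first `j` oracle calls of a round. -/
def ImproperLearner.answers (A : ImproperLearner X S k) (oracle : ERMQuery X → X → Pred)
    (t : ℕ) (h : History X t) (x : X) (s : S) : ℕ → List (X → Pred)
  | 0 => []
  | j + 1 => A.answers oracle t h x s j ++ [oracle (A.query t h x s (A.answers oracle t h x s j))]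

/-- The prediction of the learner after its `k` oracle calls. -/
def ImproperLearner.play (A : ImproperLearner X S k) (oracle : ERMQuery X → X → Pred)
    (t : ℕ) (h : History X t) (x : X) (s : S) : Pred :=
  A.predict t h x s (A.answers oracle t h x s k)

variable [MeasurableSpace X] [MeasurableSpace S]

/-- The learner's predictions in the first `T` rounds are random variables. -/
def ImproperLearner.IsMeasurable (A : ImproperLearner X S k) (oracle : ERMQuery X → X → Pred)
    (T : ℕ) : Prop :=
  ∀ t < T, Measurable fun p : (History X t × X) × S => A.play oracle t p.1.1 p.1.2 p.2

/-- The seed used in one round: `T * n` independent samples from `μ` and as many fair coins. -/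
abbrev Seed (X : Type*) (T n : ℕ) : Type _ := Fin T × Fin n → X × Bool

/-- The law of the seed. -/
noncomputable def seedLaw (μ : Measure X) (T n : ℕ) : Measure (Seed X T n) :=
  Measure.pi fun _ => μ.prod (PMF.uniformOfFintype Bool).toMeasure

/-- An adaptive adversary: the joint conditional law, given the history, of the next context and label. -/
structure Adversary (X : Type*) [MeasurableSpace X] where
  draw : (t : ℕ) → Kernel (History X t) (X × Pred)
  isMarkov : ∀ t, IsMarkovKernel (draw t)

/-- In each of the first `T` rounds, the law of the context given the history is `(f, σ)`-smooth. -/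
def Adversary.IsSmooth (adv : Adversary X) (f : ℝ≥0 → ℝ≥0∞) (σ : ℝ) (μ : Measure X) (T : ℕ) : Prop :=
  ∀ t < T, ∀ h : History X t, SmoothedOnline.IsSmooth f σ ((adv.draw t h).map Prod.fst) μ

/-- The law of the history after `t` rounds. In each round the adversary draws context and label given
the history, and, independently of these, the learner's seed is drawn from `ρ`. -/
noncomputable def gameLaw (A : ImproperLearner X S k) (oracle : ERMQuery X → X → Pred)
    (ρ : Measure S) (adv : Adversary X) : (t : ℕ) → Measure (History X t)
  | 0 => Measure.dirac Fin.elim0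
  | t + 1 =>
    (((gameLaw A oracle ρ adv t).compProd (adv.draw t)).prod ρ).map fun p =>
      (Fin.snoc p.1.1 (p.1.2.1, p.1.2.2, A.play oracle t p.1.1 p.1.2.1 p.2) : History X (t + 1))

/-- The regret of a completed game against the best function of the class in hindsight. -/
noncomputable def regret (loss : ℝ → ℝ → ℝ) (F : Set (X → Pred)) {T : ℕ} (h : History X T) : ℝ :=
  (∑ t, loss (h t).2.2 (h t).2.1) - ⨅ g : F, ∑ t, loss ((g : X → Pred) (h t).1) (h t).2.1

end Game

end SmoothedOnline

open SmoothedOnline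

/-!
The learner is a random playout. In each round it stands the hints (samples `Z k` of `μ` with random
signs) of the rows that belong to later rounds in for the future, and forms for `c = 1` and `c = -1`
the maximum over `g` in the class of

  `-(past loss of g) + c * g x + 2 * ∑ k, sign k * g (Z k)`,

where `x` is the new context. Each of the two maxima takes one oracle call (`objectiveQuery`), and
the prediction is half their difference. The past enters with the actual losses; only the current
loss is bounded, by its Lipschitz constant, through the two linear losses, so that no subgradient at
the (random) prediction is needed. The prediction equalizes these two, and whatever the label is, the
loss of the round is paid for by a perturbation `± g x` with a random sign
(`add_iSup_le_symmetrized`).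

It remains to replace the perturbation at `x`, whose law is smooth, by the hints of the current
round. The divergence bound truncates the law of `x` to a density `w ≤ s` with respect to `μ` at the
cost of a mass `ε`, where `f' s ≥ 1 / (ε σ)` (`IsSmooth.exists_density`). If `n ≥ s`, each of the `n`
hints of the row is a sample of the truncated law with probability `w / n` (rejection sampling), and
by convexity the other hints do no harm. The rejection fails altogether with a probability bounded
away from one, and the factor `2` in front of the Rademacher sum makes up for it, since by convexity
a perturbation of twice the size has at least twice the gain (`card_mul_integral_le_playout_union`).
Hence the potential `potential` increases by at most `ε` per round in expectation, and the regret is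
at most `2 * expectedRademacher F μ (n * T) + ε * T` as soon as `n ≥ s`
(`integral_regret_le_of_smooth`). No factor `log T` is lost in `n`.

For real-valued classes this is the claim. For binary classes, the saved factor `log T` pays for the
logarithm in the bound `√(2 N d log (N + 1))` on the Rademacher complexity that follows from the
Sauer-Shelah lemma and Massart's lemma, so that chaining is not needed: unless the claimed bound
exceeds the trivial bound `T`, the number `N = n * T` of samples is polynomial in `T`.

All suprema over the class are measurable because they are suprema of Carathéodory functions of
finitely many values (`IsTraceFunctional.measurable_iSup`).
-/

namespace SmoothedOnline

/-! ### Suprema over the class -/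

section Suprema

variable {I : Type*} {b c : I → ℝ} {B C : ℝ}

lemma bddAbove_range_of_abs_le (hb : ∀ i, |b i| ≤ B) : BddAbove (Set.range b) :=
  ⟨B, by rintro _ ⟨i, rfl⟩; exact (abs_le.1 (hb i)).2⟩

lemma abs_add_le_of_le {x y : ℝ} (hx : |x| ≤ B) (hy : |y| ≤ C) : |x + y| ≤ B + C :=
  (abs_add_le x y).trans (add_le_add hx hy)

lemma abs_sub_le_of_le {x y : ℝ} (hx : |x| ≤ B) (hy : |y| ≤ C) : |x - y| ≤ B + C :=
  (abs_sub x y).trans (add_le_add hx hy)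

variable [Nonempty I]

lemma abs_iSup_le (hb : ∀ i, |b i| ≤ B) : |⨆ i, b i| ≤ B := by
  obtain ⟨i⟩ := ‹Nonempty I›
  refine abs_le.2 ⟨?_, ciSup_le fun i => (abs_le.1 (hb i)).2⟩
  exact (abs_le.1 (hb i)).1.trans (le_ciSup (bddAbove_range_of_abs_le hb) i)

/-- Adding a function with a random sign does not decrease the mean of the supremum. -/
lemma iSup_le_symmetrized (hb : ∀ i, |b i| ≤ B) (hc : ∀ i, |c i| ≤ C) :
    ⨆ i, b i ≤ ((⨆ i, (b i + c i)) + ⨆ i, (b i - c i)) / 2 := by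
  refine ciSup_le fun i => ?_
  have h1 := le_ciSup (bddAbove_range_of_abs_le fun i => abs_add_le_of_le (hb i) (hc i)) i
  have h2 := le_ciSup (bddAbove_range_of_abs_le fun i => abs_sub_le_of_le (hb i) (hc i)) i
  linarith

lemma symmetrized_le_iSup_add (hb : ∀ i, |b i| ≤ B) (hc : ∀ i, |c i| ≤ 1) :
    ((⨆ i, (b i + c i)) + ⨆ i, (b i - c i)) / 2 ≤ (⨆ i, b i) + 1 := by
  have h1 : ⨆ i, (b i + c i) ≤ (⨆ i, b i) + 1 := ciSup_le fun i =>
    add_le_add (le_ciSup (bddAbove_range_of_abs_le hb) i) (abs_le.1 (hc i)).2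
  have h2 : ⨆ i, (b i - c i) ≤ (⨆ i, b i) + 1 := ciSup_le fun i => by
    have := le_ciSup (bddAbove_range_of_abs_le hb) i
    have := (abs_le.1 (hc i)).1
    linarith
  linarith

/-- By convexity in the scale of the perturbation, doubling it at least doubles the gain. -/
lemma two_mul_symmetrized_le (hb : ∀ i, |b i| ≤ B) (hc : ∀ i, |c i| ≤ C) :
    2 * (((⨆ i, (b i + c i)) + ⨆ i, (b i - c i)) / 2 - ⨆ i, b i) ≤
      ((⨆ i, (b i + 2 * c i)) + ⨆ i, (b i - 2 * c i)) / 2 - ⨆ i, b i := by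
  have hc2 : ∀ i, |2 * c i| ≤ 2 * C := fun i => by
    rw [abs_mul, abs_two]; linarith [hc i]
  have h0 := bddAbove_range_of_abs_le hb
  have h1 : ⨆ i, (b i + c i) ≤ ((⨆ i, b i) + ⨆ i, (b i + 2 * c i)) / 2 := ciSup_le fun i => by
    have := le_ciSup h0 i
    have := le_ciSup (bddAbove_range_of_abs_le fun i => abs_add_le_of_le (hb i) (hc2 i)) i
    linarith
  have h2 : ⨆ i, (b i - c i) ≤ ((⨆ i, b i) + ⨆ i, (b i - 2 * c i)) / 2 := ciSup_le fun i => by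
    have := le_ciSup h0 i
    have := le_ciSup (bddAbove_range_of_abs_le fun i => abs_sub_le_of_le (hb i) (hc2 i)) i
    linarith
  linarith

end Suprema

/-! ### Measurability of suprema over a class with measurable traces -/

section TraceFunctional

variable {X P Q : Type*} [MeasurableSpace X] [MeasurableSpace P] [MeasurableSpace Q]

/-- A functional of `g` depending on a parameter `p`, which is a Carathéodory function (continuous in
the values, measurable in `p`) of the values of `g` at finitely many points that depend measurably
on `p`. -/
def IsTraceFunctional (b : P → (X → Pred) → ℝ) : Prop :=
  ∃ (m : ℕ) (x : P → Fin m → X) (Φ : P → (Fin m → Pred) → ℝ), Measurable x ∧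
    (∀ a, Measurable fun p => Φ p a) ∧ (∀ p, Continuous (Φ p)) ∧
    ∀ p g, b p g = Φ p fun i => g (x p i)

lemma IsTraceFunctional.comp {b : P → (X → Pred) → ℝ} (hb : IsTraceFunctional b) {u : Q → P}
    (hu : Measurable u) : IsTraceFunctional fun q => b (u q) := by
  obtain ⟨m, x, Φ, hx, hm, hc, h⟩ := hb
  exact ⟨m, fun q => x (u q), fun q => Φ (u q), hx.comp hu, fun a => (hm a).comp hu,
    fun q => hc _, fun q g => h _ _⟩

lemma IsTraceFunctional.eval {x : P → X} (hx : Measurable x) {Φ : P → Pred → ℝ}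
    (hm : ∀ a, Measurable fun p => Φ p a) (hc : ∀ p, Continuous (Φ p)) :
    IsTraceFunctional fun p (g : X → Pred) => Φ p (g (x p)) :=
  ⟨1, fun p _ => x p, fun p a => Φ p (a 0), measurable_pi_lambda _ fun _ => hx,
    fun _ => hm _, fun p => (hc p).comp (continuous_apply 0), fun _ _ => rfl⟩

lemma IsTraceFunctional.zero : IsTraceFunctional fun (_ : P) (_ : X → Pred) => (0 : ℝ) :=
  ⟨0, fun _ => Fin.elim0, fun _ _ => 0, measurable_const, fun _ => measurable_const,
    fun _ => continuous_const, fun _ _ => rfl⟩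

lemma IsTraceFunctional.add {b c : P → (X → Pred) → ℝ} (hb : IsTraceFunctional b)
    (hc : IsTraceFunctional c) : IsTraceFunctional fun p g => b p g + c p g := by
  obtain ⟨m, x, Φ, hx, hm, hcont, h⟩ := hb
  obtain ⟨m', x', Φ', hx', hm', hcont', h'⟩ := hc
  refine ⟨m + m', fun p => Fin.append (x p) (x' p),
    fun p a => Φ p (fun i => a (Fin.castAdd m' i)) + Φ' p (fun i => a (Fin.natAdd m i)),
    measurable_pi_lambda _ fun i => ?_, fun a => (hm _).add (hm' _),
    fun p => ((hcont p).comp (by fun_prop)).add ((hcont' p).comp (by fun_prop)),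
    fun p g => by simp [h, h']⟩
  refine Fin.addCases (fun j => ?_) (fun j => ?_) i
  · simpa [Function.comp_def] using (measurable_pi_apply j).comp hx
  · simpa [Function.comp_def] using (measurable_pi_apply j).comp hx'

lemma IsTraceFunctional.const_mul {b : P → (X → Pred) → ℝ} (hb : IsTraceFunctional b) (r : ℝ) :
    IsTraceFunctional fun p g => r * b p g := by
  obtain ⟨m, x, Φ, hx, hm, hcont, h⟩ := hb
  exact ⟨m, x, fun p a => r * Φ p a, hx, fun a => (hm a).const_mul r,
    fun p => (hcont p).const_mul r, fun p g => by simp [h]⟩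

lemma IsTraceFunctional.neg {b : P → (X → Pred) → ℝ} (hb : IsTraceFunctional b) :
    IsTraceFunctional fun p g => -b p g := by
  simpa using hb.const_mul (-1)

lemma IsTraceFunctional.sub {b c : P → (X → Pred) → ℝ} (hb : IsTraceFunctional b)
    (hc : IsTraceFunctional c) : IsTraceFunctional fun p g => b p g - c p g := by
  simpa [sub_eq_add_neg] using hb.add hc.neg

lemma IsTraceFunctional.sum {κ : Type*} {b : κ → P → (X → Pred) → ℝ} (s : Finset κ)
    (hb : ∀ k ∈ s, IsTraceFunctional (b k)) :
    IsTraceFunctional fun p g => ∑ k ∈ s, b k p g := by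
  classical
  induction s using Finset.induction_on with
  | empty => simpa using IsTraceFunctional.zero
  | insert k s hk ih =>
    simp only [Finset.sum_insert hk]
    exact (hb k (Finset.mem_insert_self k s)).add
      (ih fun j hj => hb j (Finset.mem_insert_of_mem hj))

/-- A supremum over a class with measurable traces exceeds `r` if and only if, for some `q > r`, the
traces of the class meet an open set of a countable basis on which the functional is at least `q`, and
the latter need only be tested on a countable dense set. -/
theorem IsTraceFunctional.measurable_iSup {F : Set (X → Pred)} (hF : HasMeasurableTraces F)
    (hne : F.Nonempty) {b : P → (X → Pred) → ℝ} (hb : IsTraceFunctional b) :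
    Measurable fun p => ⨆ g : F, b p g := by
  obtain ⟨m, x, Φ, hx, hm, hcont, h⟩ := hb
  have : Nonempty F := hne.to_subtype
  have : Nonempty Pred := ⟨⟨0, by norm_num⟩⟩
  refine measurable_of_Ioi fun r => ?_
  let D := TopologicalSpace.denseSeq (Fin m → Pred)
  let 𝓑 := TopologicalSpace.countableBasis (Fin m → Pred)
  have hset : (fun p => ⨆ g : F, b p g) ⁻¹' Set.Ioi r = ⋃ U ∈ 𝓑, ⋃ q : ℚ, ⋃ _ : r < q,
      {p | ∃ g ∈ F, (fun i => g (x p i)) ∈ U} ∩ {p | ∀ k, D k ∈ U → (q : ℝ) ≤ Φ p (D k)} := by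
    ext p
    simp only [Set.mem_preimage, Set.mem_Ioi, Set.mem_iUnion, Set.mem_inter_iff, Set.mem_ofPred_eq,
      exists_prop]
    constructor
    · intro hp
      obtain ⟨g, hg⟩ := exists_lt_of_lt_ciSup hp
      obtain ⟨q, hrq, hq⟩ := exists_rat_btwn hg
      rw [h] at hq
      obtain ⟨U, hU, hgU, hsub⟩ :=
        (TopologicalSpace.isBasis_countableBasis (Fin m → Pred)).exists_subset_of_mem_open
          (show (fun i => (g : X → Pred) (x p i)) ∈ Φ p ⁻¹' Set.Ioi (q : ℝ) from hq)
          (isOpen_Ioi.preimage (hcont p))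
      exact ⟨U, hU, q, hrq, ⟨g, g.2, hgU⟩, fun k hk => (hsub hk).le⟩
    · rintro ⟨U, hU, q, hrq, ⟨g, hg, hgU⟩, hq⟩
      have hUo : IsOpen U := (TopologicalSpace.isBasis_countableBasis _).isOpen hU
      have hle : (q : ℝ) ≤ Φ p fun i => g (x p i) := by
        have hcl : (fun i => g (x p i)) ∈ closure (U ∩ Set.range D) :=
          (TopologicalSpace.denseRange_denseSeq _).open_subset_closure_inter hUo hgU
        have hsub : closure (U ∩ Set.range D) ⊆ Φ p ⁻¹' Set.Ici (q : ℝ) := by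
          refine closure_minimal ?_ (isClosed_Ici.preimage (hcont p))
          rintro _ ⟨hU, k, rfl⟩
          exact hq k hU
        exact hsub hcl
      have hbdd : BddAbove (Set.range fun g : F => b p g) := by
        obtain ⟨B, hB⟩ := (isCompact_univ.image (hcont p)).bddAbove
        refine ⟨B, ?_⟩
        rintro _ ⟨g, rfl⟩
        exact hB ⟨_, Set.mem_univ _, (h p g).symm⟩
      calc r < q := hrq
        _ ≤ b p g := by rw [h]; exact hle
        _ ≤ _ := le_ciSup hbdd (⟨g, hg⟩ : F)
  rw [hset]
  refine MeasurableSet.biUnion (TopologicalSpace.countable_countableBasis _) fun U hU =>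
    MeasurableSet.iUnion fun q => MeasurableSet.iUnion fun _ => MeasurableSet.inter ?_ ?_
  · exact hx (hF m U ((TopologicalSpace.isBasis_countableBasis _).isOpen hU))
  · simp only [Set.ofPred_forall]
    exact MeasurableSet.iInter fun k => MeasurableSet.iInter fun _ =>
      measurableSet_le measurable_const (hm _)

end TraceFunctional

/-! ### The random playout -/

section Playout

variable {X ι : Type*}

lemma abs_sign_mul_pred (e : Bool) (a : Pred) : |sign e * (a : ℝ)| ≤ 1 := by
  have : |(a : ℝ)| ≤ 1 := abs_le.2 a.2
  cases e <;> simpa [sign] using this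

lemma abs_hintSum_le (S : Finset ι) (ω : ι → X × Bool) (g : X → Pred) :
    |2 * ∑ k ∈ S, sign (ω k).2 * (g (ω k).1 : ℝ)| ≤ 2 * S.card := by
  rw [abs_mul, abs_two]
  refine mul_le_mul_of_nonneg_left ((Finset.abs_sum_le_sum_abs _ _).trans ?_) zero_le_two
  simpa using Finset.sum_le_card_nsmul S _ 1 fun k _ => abs_sign_mul_pred (ω k).2 (g (ω k).1)

lemma abs_mul_eval_le (r : ℝ) (g : X → Pred) (z : X) : |r * (g z : ℝ)| ≤ |r| := by
  rw [abs_mul]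
  exact mul_le_of_le_one_right (abs_nonneg r) (abs_le.2 (g z).2)

/-- The supremum over the class of `b` plus twice the Rademacher sum over the hints in `S`. -/
noncomputable def perturbedSup (F : Set (X → Pred)) (S : Finset ι) (ω : ι → X × Bool)
    (b : (X → Pred) → ℝ) : ℝ :=
  ⨆ g : F, (b g + 2 * ∑ k ∈ S, sign (ω k).2 * ((g : X → Pred) (ω k).1 : ℝ))

variable {F : Set (X → Pred)} {S R : Finset ι} {b : (X → Pred) → ℝ} {B : ℝ}

lemma abs_perturbedSup_le (hne : F.Nonempty) (hB : ∀ g ∈ F, |b g| ≤ B) (ω : ι → X × Bool) :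
    |perturbedSup F S ω b| ≤ B + 2 * S.card := by
  have : Nonempty F := hne.to_subtype
  exact abs_iSup_le fun g => abs_add_le_of_le (hB g g.2) (abs_hintSum_le S ω g)

variable [MeasurableSpace X]

/-- The law of one labelled hint: a sample of `μ` and an independent fair coin. -/
noncomputable def hintLaw (μ : Measure X) : Measure (X × Bool) :=
  μ.prod (PMF.uniformOfFintype Bool).toMeasure

instance (μ : Measure X) [IsProbabilityMeasure μ] : IsProbabilityMeasure (hintLaw μ) := by
  unfold hintLaw; infer_instance

lemma integral_fairCoin (u : Bool → ℝ) :
    ∫ e, u e ∂(PMF.uniformOfFintype Bool).toMeasure = (u true + u false) / 2 := by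
  rw [PMF.integral_eq_sum]
  simp
  ring

/-- The expectation of `perturbedSup` over independent hints. -/
noncomputable def playout [Fintype ι] (F : Set (X → Pred)) (μ : Measure X) (S : Finset ι)
    (b : (X → Pred) → ℝ) : ℝ :=
  ∫ ω, perturbedSup F S ω b ∂(Measure.pi fun _ : ι => hintLaw μ)

/-- The expected playout after the functional `b` is perturbed by the value at `z` times `r` times a
random sign. -/
noncomputable def symmPlayout [Fintype ι] (F : Set (X → Pred)) (μ : Measure X) (S : Finset ι)
    (b : (X → Pred) → ℝ) (r : ℝ) (z : X) : ℝ :=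
  (playout F μ S (fun g => b g + r * (g z : ℝ)) + playout F μ S (fun g => b g - r * (g z : ℝ))) / 2

variable {μ : Measure X}

lemma isTraceFunctional_hintSum (S : Finset ι) :
    IsTraceFunctional fun (ω : ι → X × Bool) g =>
      2 * ∑ k ∈ S, sign (ω k).2 * (g (ω k).1 : ℝ) := by
  refine (IsTraceFunctional.sum S fun k _ => ?_).const_mul 2
  refine IsTraceFunctional.eval (x := fun ω : ι → X × Bool => (ω k).1)
    (Φ := fun ω a => sign (ω k).2 * (a : ℝ)) (by fun_prop) (fun a => ?_) (fun ω => by fun_prop)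
  exact ((measurable_from_top (f := sign)).comp (by fun_prop)).mul_const _

lemma isTraceFunctional_mul_eval {P : Type*} [MeasurableSpace P] (r : ℝ) {x : P → X}
    (hx : Measurable x) : IsTraceFunctional fun p (g : X → Pred) => r * (g (x p) : ℝ) :=
  (IsTraceFunctional.eval hx (Φ := fun _ a => (a : ℝ)) (fun _ => measurable_const)
    fun _ => by fun_prop).const_mul r

lemma measurable_perturbedSup {P : Type*} [MeasurableSpace P] {b : P → (X → Pred) → ℝ}
    (hF : HasMeasurableTraces F) (hne : F.Nonempty) (hb : IsTraceFunctional b) (S : Finset ι) :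
    Measurable fun q : P × (ι → X × Bool) => perturbedSup F S q.2 (b q.1) :=
  ((hb.comp measurable_fst).add ((isTraceFunctional_hintSum S).comp measurable_snd)).measurable_iSup
    hF hne

lemma measurable_perturbedSup_const (hF : HasMeasurableTraces F) (hne : F.Nonempty)
    (hb : IsTraceFunctional fun _ : Unit => b) (S : Finset ι) :
    Measurable fun ω : ι → X × Bool => perturbedSup F S ω b :=
  ((hb.comp (u := fun _ : ι → X × Bool => ()) measurable_const).add
    (isTraceFunctional_hintSum S)).measurable_iSup hF hne

variable [Fintype ι] [IsProbabilityMeasure μ]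

lemma integrable_perturbedSup (hF : HasMeasurableTraces F) (hne : F.Nonempty)
    (hb : IsTraceFunctional fun _ : Unit => b) (hB : ∀ g ∈ F, |b g| ≤ B) (S : Finset ι) :
    Integrable (fun ω => perturbedSup F S ω b) (Measure.pi fun _ : ι => hintLaw μ) := by
  refine Integrable.of_bound (measurable_perturbedSup_const hF hne hb S).aestronglyMeasurable
    (B + 2 * S.card) (ae_of_all _ fun ω => ?_)
  rw [Real.norm_eq_abs]
  exact abs_perturbedSup_le hne hB ω

lemma abs_playout_le (hne : F.Nonempty) (hB : ∀ g ∈ F, |b g| ≤ B) :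
    |playout F μ S b| ≤ B + 2 * S.card := by
  refine (norm_integral_le_of_norm_le_const (C := B + 2 * S.card)
    (μ := Measure.pi fun _ : ι => hintLaw μ) (ae_of_all _ fun ω => by
      rw [Real.norm_eq_abs]; exact abs_perturbedSup_le hne hB ω)).trans ?_
  simp

lemma measurable_playout {P : Type*} [MeasurableSpace P] {b : P → (X → Pred) → ℝ}
    (hF : HasMeasurableTraces F) (hne : F.Nonempty) (hb : IsTraceFunctional b) (S : Finset ι) :
    Measurable fun p => playout F μ S (b p) :=
  ((measurable_perturbedSup hF hne hb S).stronglyMeasurable.integral_prod_right').measurable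

lemma isTraceFunctional_add_eval (hb : IsTraceFunctional fun _ : Unit => b) (r : ℝ) :
    IsTraceFunctional fun (z : X) g => b g + r * (g z : ℝ) :=
  (hb.comp (u := fun _ : X => ()) measurable_const).add (isTraceFunctional_mul_eval r measurable_id)

lemma isTraceFunctional_sub_eval (hb : IsTraceFunctional fun _ : Unit => b) (r : ℝ) :
    IsTraceFunctional fun (z : X) g => b g - r * (g z : ℝ) :=
  (hb.comp (u := fun _ : X => ()) measurable_const).sub (isTraceFunctional_mul_eval r measurable_id)

lemma isTraceFunctional_add_eval_const (hb : IsTraceFunctional fun _ : Unit => b) (r : ℝ) (z : X) :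
    IsTraceFunctional fun (_ : Unit) g => b g + r * (g z : ℝ) :=
  (isTraceFunctional_add_eval hb r).comp (u := fun _ : Unit => z) measurable_const

lemma isTraceFunctional_sub_eval_const (hb : IsTraceFunctional fun _ : Unit => b) (r : ℝ) (z : X) :
    IsTraceFunctional fun (_ : Unit) g => b g - r * (g z : ℝ) :=
  (isTraceFunctional_sub_eval hb r).comp (u := fun _ : Unit => z) measurable_const

lemma measurable_symmPlayout (hF : HasMeasurableTraces F) (hne : F.Nonempty)
    (hb : IsTraceFunctional fun _ : Unit => b) (S : Finset ι) (r : ℝ) :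
    Measurable (symmPlayout F μ S b r) :=
  ((measurable_playout hF hne (isTraceFunctional_add_eval hb r) S).add
    (measurable_playout hF hne (isTraceFunctional_sub_eval hb r) S)).div_const 2

lemma integral_hintLaw {u : X × Bool → ℝ} (hu : Integrable u (hintLaw μ)) :
    ∫ q, u q ∂(hintLaw μ) = ∫ z, (u (z, true) + u (z, false)) / 2 ∂μ := by
  rw [hintLaw] at hu ⊢
  simp only [integral_prod _ hu, integral_fairCoin]

lemma abs_symmPlayout_le (hne : F.Nonempty) (hB : ∀ g ∈ F, |b g| ≤ B) (r : ℝ) (z : X) :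
    |symmPlayout F μ S b r z| ≤ B + |r| + 2 * S.card := by
  have h1 := abs_playout_le (μ := μ) (S := S) hne
    fun g hg => abs_add_le_of_le (hB g hg) (abs_mul_eval_le r g z)
  have h2 := abs_playout_le (μ := μ) (S := S) hne
    fun g hg => abs_sub_le_of_le (hB g hg) (abs_mul_eval_le r g z)
  rw [symmPlayout, abs_le]
  constructor <;> linarith [abs_le.1 h1, abs_le.1 h2]

lemma symmPlayout_eq_integral (hF : HasMeasurableTraces F) (hne : F.Nonempty)
    (hb : IsTraceFunctional fun _ : Unit => b) (hB : ∀ g ∈ F, |b g| ≤ B) (S : Finset ι) (r : ℝ)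
    (z : X) :
    symmPlayout F μ S b r z = ∫ ω, (perturbedSup F S ω (fun g => b g + r * (g z : ℝ)) +
      perturbedSup F S ω (fun g => b g - r * (g z : ℝ))) / 2 ∂(Measure.pi fun _ : ι => hintLaw μ) := by
  rw [integral_div, integral_add, symmPlayout]
  · rfl
  · exact integrable_perturbedSup hF hne (isTraceFunctional_add_eval_const hb r z)
      (fun g hg => abs_add_le_of_le (hB g hg) (abs_mul_eval_le r g z)) S
  · exact integrable_perturbedSup hF hne (isTraceFunctional_sub_eval_const hb r z)
      (fun g hg => abs_sub_le_of_le (hB g hg) (abs_mul_eval_le r g z)) S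

lemma integrable_perturbedSup_symm (hF : HasMeasurableTraces F) (hne : F.Nonempty)
    (hb : IsTraceFunctional fun _ : Unit => b) (hB : ∀ g ∈ F, |b g| ≤ B) (S : Finset ι) (r : ℝ)
    (z : X) :
    Integrable (fun ω => (perturbedSup F S ω (fun g => b g + r * (g z : ℝ)) +
      perturbedSup F S ω (fun g => b g - r * (g z : ℝ))) / 2)
      (Measure.pi fun _ : ι => hintLaw μ) :=
  ((integrable_perturbedSup hF hne (isTraceFunctional_add_eval_const hb r z)
      (fun g hg => abs_add_le_of_le (hB g hg) (abs_mul_eval_le r g z)) S).add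
    (integrable_perturbedSup hF hne (isTraceFunctional_sub_eval_const hb r z)
      (fun g hg => abs_sub_le_of_le (hB g hg) (abs_mul_eval_le r g z)) S)).div_const 2

lemma playout_le_symmPlayout (hF : HasMeasurableTraces F) (hne : F.Nonempty)
    (hb : IsTraceFunctional fun _ : Unit => b) (hB : ∀ g ∈ F, |b g| ≤ B) (S : Finset ι) (r : ℝ)
    (z : X) : playout F μ S b ≤ symmPlayout F μ S b r z := by
  have : Nonempty F := hne.to_subtype
  rw [symmPlayout_eq_integral hF hne hb hB]
  refine integral_mono (integrable_perturbedSup hF hne hb hB S)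
    (integrable_perturbedSup_symm hF hne hb hB S r z) fun ω => ?_
  have := iSup_le_symmetrized (I := F) (c := fun g => r * ((g : X → Pred) z : ℝ))
    (fun g => abs_add_le_of_le (hB g g.2) (abs_hintSum_le S ω g))
    (fun g => abs_mul_eval_le r g z)
  simpa only [perturbedSup, add_right_comm, add_sub_right_comm] using this

lemma symmPlayout_one_le (hF : HasMeasurableTraces F) (hne : F.Nonempty)
    (hb : IsTraceFunctional fun _ : Unit => b) (hB : ∀ g ∈ F, |b g| ≤ B) (S : Finset ι)
    (z : X) : symmPlayout F μ S b 1 z ≤ playout F μ S b + 1 := by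
  have : Nonempty F := hne.to_subtype
  have h1 : playout F μ S b + 1 =
      ∫ ω, (perturbedSup F S ω b + 1) ∂(Measure.pi fun _ : ι => hintLaw μ) := by
    rw [integral_add (integrable_perturbedSup hF hne hb hB S) (integrable_const _)]
    simp [playout]
  rw [symmPlayout_eq_integral hF hne hb hB, h1]
  refine integral_mono (integrable_perturbedSup_symm hF hne hb hB S 1 z)
    ((integrable_perturbedSup hF hne hb hB S).add (integrable_const _)) fun ω => ?_
  have := symmetrized_le_iSup_add (I := F) (c := fun g => 1 * ((g : X → Pred) z : ℝ))
    (fun g => abs_add_le_of_le (hB g g.2) (abs_hintSum_le S ω g))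
    (fun g => by simpa using abs_mul_eval_le 1 (g : X → Pred) z)
  simpa only [perturbedSup, add_right_comm, add_sub_right_comm] using this

lemma two_mul_symmPlayout_le (hF : HasMeasurableTraces F) (hne : F.Nonempty)
    (hb : IsTraceFunctional fun _ : Unit => b) (hB : ∀ g ∈ F, |b g| ≤ B) (S : Finset ι)
    (z : X) : 2 * (symmPlayout F μ S b 1 z - playout F μ S b) ≤
      symmPlayout F μ S b 2 z - playout F μ S b := by
  have : Nonempty F := hne.to_subtype
  have hi := integrable_perturbedSup (μ := μ) hF hne hb hB S
  have hi1 := integrable_perturbedSup_symm (μ := μ) hF hne hb hB S 1 z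
  have hi2 := integrable_perturbedSup_symm (μ := μ) hF hne hb hB S 2 z
  rw [symmPlayout_eq_integral hF hne hb hB, symmPlayout_eq_integral hF hne hb hB, playout,
    ← integral_sub hi1 hi, ← integral_sub hi2 hi, ← integral_const_mul]
  refine integral_mono ((hi1.sub hi).const_mul 2) (hi2.sub hi) fun ω => ?_
  have := two_mul_symmetrized_le (I := F) (c := fun g => ((g : X → Pred) z : ℝ)) (C := 1)
    (fun g => abs_add_le_of_le (hB g g.2) (abs_hintSum_le S ω g))
    (fun g => by simpa using abs_mul_eval_le 1 (g : X → Pred) z)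
  simpa only [perturbedSup, add_right_comm, add_sub_right_comm, one_mul] using this

/-- Redrawing one coordinate of a vector with independent coordinates preserves its law. -/
lemma measurePreserving_update {Y : Type*} [MeasurableSpace Y] (m : Measure Y)
    [IsProbabilityMeasure m] [DecidableEq ι] (k : ι) :
    MeasurePreserving (fun p : (ι → Y) × Y => Function.update p.1 k p.2)
      ((Measure.pi fun _ : ι => m).prod m) (Measure.pi fun _ : ι => m) := by
  have hmeas : Measurable fun p : (ι → Y) × Y => Function.update p.1 k p.2 := by
    refine measurable_pi_lambda _ fun j => ?_
    by_cases h : j = k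
    · subst h; simpa using measurable_snd
    · simpa [Function.update_of_ne h, Function.comp_def] using (measurable_pi_apply j).comp measurable_fst
  refine ⟨hmeas, (Measure.pi_eq fun s hs => ?_).symm⟩
  rw [Measure.map_apply hmeas (MeasurableSet.univ_pi hs)]
  have : (fun p : (ι → Y) × Y => Function.update p.1 k p.2) ⁻¹' Set.univ.pi s =
      (Set.univ.pi (Function.update s k Set.univ)) ×ˢ s k := by
    ext p
    simp only [Set.mem_preimage, Set.mem_pi, Set.mem_univ, true_imp_iff, Set.mem_prod]
    constructor
    · intro h
      refine ⟨fun j => ?_, by simpa using h k⟩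
      by_cases hj : j = k
      · subst hj; simp
      · simpa [Function.update_of_ne hj] using h j
    · rintro ⟨h1, h2⟩ j
      by_cases hj : j = k
      · subst hj; simpa using h2
      · simpa [Function.update_of_ne hj] using h1 j
  rw [this, Measure.prod_prod, Measure.pi_pi,
    ← Finset.mul_prod_erase _ _ (Finset.mem_univ k),
    ← Finset.mul_prod_erase _ (fun i => m (s i)) (Finset.mem_univ k), mul_comm (m (s k))]
  simp only [Function.update_self, measure_univ, one_mul]
  congr 1
  refine Finset.prod_congr rfl fun j hj => ?_
  rw [Function.update_of_ne (Finset.ne_of_mem_erase hj)]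

/-- One more hint is the same as a perturbation of size two at a point with law `μ`. -/
lemma playout_insert [DecidableEq ι] (hF : HasMeasurableTraces F) (hne : F.Nonempty)
    (hb : IsTraceFunctional fun _ : Unit => b) (hB : ∀ g ∈ F, |b g| ≤ B) {k : ι} (hk : k ∉ S) :
    playout F μ (insert k S) b = ∫ z, symmPlayout F μ S b 2 z ∂μ := by
  have hmp := measurePreserving_update (ι := ι) (hintLaw μ) k
  have hm : Measurable fun ω : ι → X × Bool => perturbedSup F (insert k S) ω b :=
    measurable_perturbedSup_const hF hne hb _
  have key : ∀ (ω : ι → X × Bool) (z : X) (e : Bool),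
      perturbedSup F (insert k S) (Function.update ω k (z, e)) b =
        perturbedSup F S ω fun g => b g + (2 * sign e) * (g z : ℝ) := by
    intro ω z e
    simp only [perturbedSup]
    congr 1; ext g
    rw [Finset.sum_insert hk, Function.update_self]
    have : ∑ j ∈ S, sign (Function.update ω k (z, e) j).2 *
        ((g : X → Pred) (Function.update ω k (z, e) j).1 : ℝ) =
        ∑ j ∈ S, sign (ω j).2 * ((g : X → Pred) (ω j).1 : ℝ) :=
      Finset.sum_congr rfl fun j hj => by
        rw [Function.update_of_ne (ne_of_mem_of_not_mem hj hk)]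
    rw [this]; ring
  have hint : Integrable (fun p : (ι → X × Bool) × (X × Bool) =>
      perturbedSup F (insert k S) (Function.update p.1 k p.2) b)
      ((Measure.pi fun _ : ι => hintLaw μ).prod (hintLaw μ)) :=
    hmp.integrable_comp_of_integrable (integrable_perturbedSup hF hne hb hB _)
  have hint2 : Integrable (fun q : X × Bool => ∫ ω, perturbedSup F (insert k S)
      (Function.update ω k q) b ∂(Measure.pi fun _ : ι => hintLaw μ)) (hintLaw μ) :=
    hint.integral_prod_right
  rw [playout, ← hmp.map_eq, integral_map hmp.measurable.aemeasurable
    hm.aestronglyMeasurable, integral_prod_symm _ hint, integral_hintLaw hint2]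
  refine integral_congr_ae (ae_of_all _ fun z => ?_)
  simp only [key, symmPlayout, playout, sign, if_true, mul_one, mul_neg,
    neg_mul, sub_eq_add_neg, Bool.false_eq_true, if_false]

lemma playout_mono [DecidableEq ι] (hF : HasMeasurableTraces F) (hne : F.Nonempty)
    (hb : IsTraceFunctional fun _ : Unit => b) (hB : ∀ g ∈ F, |b g| ≤ B) (h : S ⊆ R) :
    playout F μ S b ≤ playout F μ R b := by
  have hstep : ∀ (S : Finset ι) (k : ι), k ∉ S → playout F μ S b ≤ playout F μ (insert k S) b := by
    intro S k hk
    rw [playout_insert hF hne hb hB hk]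
    have : playout F μ S b = ∫ _, playout F μ S b ∂μ := by simp
    rw [this]
    refine integral_mono (integrable_const _) ?_
      fun z => playout_le_symmPlayout hF hne hb hB S 2 z
    exact Integrable.of_bound (measurable_symmPlayout hF hne hb S 2).aestronglyMeasurable _
      (ae_of_all _ fun z => abs_symmPlayout_le hne hB 2 z)
  have : ∀ R' : Finset ι, Disjoint S R' → playout F μ S b ≤ playout F μ (S ∪ R') b := by
    intro R'
    induction R' using Finset.induction_on with
    | empty => simp
    | insert k R' hk ih =>
      intro hd
      rw [Finset.disjoint_insert_right] at hd
      rw [Finset.union_insert]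
      exact (ih hd.2).trans (hstep _ k (by simp [hd.1, hk]))
  simpa [Finset.union_sdiff_of_subset h] using this (R \ S) Finset.disjoint_sdiff

/-- `n` hints of size two from `μ` make up for a perturbation of size one at a point whose law has a
density `n * w ≤ n` with respect to `μ`. The proof adds the hints one by one: with probability `w`
the new one is taken as a sample of this law, and otherwise it is discarded by convexity. -/
lemma card_mul_integral_le_playout_union [DecidableEq ι] (hF : HasMeasurableTraces F)
    (hne : F.Nonempty) (hb : IsTraceFunctional fun _ : Unit => b) (hB : ∀ g ∈ F, |b g| ≤ B)
    {n : ℕ} (hn : 0 < n) {w : X → ℝ} (hw : Measurable w) (hw0 : ∀ z, 0 ≤ w z)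
    (hw1 : ∀ z, w z ≤ 1) (hwn : ∫ z, w z ∂μ ≤ 1 / n) (hd : Disjoint S R) (hR : R.card ≤ n) :
    R.card * (∫ z, w z * (symmPlayout F μ S b 1 z - playout F μ S b) ∂μ) ≤
      playout F μ (S ∪ R) b - playout F μ S b := by
  set a := playout F μ S b with ha
  set I := ∫ z, w z * (symmPlayout F μ S b 1 z - a) ∂μ with hI
  have hiw : Integrable w μ := Integrable.of_bound (C := 1) hw.aestronglyMeasurable
    (ae_of_all _ fun z => by rw [Real.norm_of_nonneg (hw0 z)]; exact hw1 z)
  have hiA : ∀ (S : Finset ι) r, Integrable (symmPlayout F μ S b r) μ := fun S r =>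
    Integrable.of_bound (measurable_symmPlayout hF hne hb S r).aestronglyMeasurable _
      (ae_of_all _ fun z => abs_symmPlayout_le hne hB r z)
  have hiwA : ∀ r, Integrable (fun z => w z * (symmPlayout F μ S b r z - a)) μ := fun r =>
    ((hiA S r).sub (integrable_const a)).bdd_mul (c := 1) hw.aestronglyMeasurable
      (ae_of_all _ fun z => by rw [Real.norm_of_nonneg (hw0 z)]; exact hw1 z)
  have hI0 : 0 ≤ I := integral_nonneg fun z => mul_nonneg (hw0 z)
    (sub_nonneg.2 (playout_le_symmPlayout hF hne hb hB S 1 z))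
  have hn' : (0 : ℝ) < n := by exact_mod_cast hn
  induction R using Finset.induction_on with
  | empty => simp [ha]
  | insert k R hk ih =>
    rw [Finset.disjoint_insert_right] at hd
    rw [Finset.card_insert_of_notMem hk] at hR ⊢
    have ih := ih hd.2 (by omega)
    have hkSR : k ∉ S ∪ R := by simp [hd.1, hk]
    rw [Finset.union_insert, playout_insert hF hne hb hB hkSR]
    have hmono : ∀ z, symmPlayout F μ S b 2 z ≤ symmPlayout F μ (S ∪ R) b 2 z := fun z => by
      have h1 := playout_mono (μ := μ) hF hne (isTraceFunctional_add_eval_const hb 2 z)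
        (fun g hg => abs_add_le_of_le (hB g hg) (abs_mul_eval_le 2 g z))
        (Finset.subset_union_left (s₁ := S) (s₂ := R))
      have h2 := playout_mono (μ := μ) hF hne (isTraceFunctional_sub_eval_const hb 2 z)
        (fun g hg => abs_sub_le_of_le (hB g hg) (abs_mul_eval_le 2 g z))
        (Finset.subset_union_left (s₁ := S) (s₂ := R))
      simp only [symmPlayout]
      linarith
    set a' := playout F μ (S ∪ R) b with ha'
    have hlow : ∀ z, 2 * (w z * (symmPlayout F μ S b 1 z - a)) + (a' + w z * (a - a')) ≤
        symmPlayout F μ (S ∪ R) b 2 z := fun z => by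
      have h1 := playout_le_symmPlayout (μ := μ) hF hne hb hB (S ∪ R) 2 z
      have h2 := two_mul_symmPlayout_le (μ := μ) hF hne hb hB S z
      have h3 := mul_nonneg (sub_nonneg.2 (hw1 z)) (sub_nonneg.2 h1)
      have h4 := mul_nonneg (hw0 z) (sub_nonneg.2 ((h2.trans (sub_le_sub_right (hmono z) _))))
      rw [← ha, ← ha'] at *
      nlinarith
    have hint := integral_mono (μ := μ) (((hiwA 1).const_mul 2).add
      ((integrable_const a').add (hiw.mul_const (a - a')))) (hiA (S ∪ R) 2) hlow
    rw [integral_add' ((hiwA 1).const_mul 2) ((integrable_const a').add (hiw.mul_const _)),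
      integral_add' (integrable_const a') (hiw.mul_const _), integral_const_mul,
      integral_mul_const] at hint
    simp only [integral_const, probReal_univ, one_smul] at hint
    set p := ∫ z, w z ∂μ
    rw [← hI] at hint
    -- The new hint gains `2 * I` and keeps at least the fraction `1 - 1 / n` of the old gain, which
    -- by induction is worth a loss of at most `I`, since there were less than `n` hints before.
    have hRn : (R.card : ℝ) + 1 ≤ n := by exact_mod_cast hR
    have h5 : (p - 1 / n) * (a' - a) ≤ 0 :=
      mul_nonpos_of_nonpos_of_nonneg (by linarith) (le_trans (by positivity) ih)
    push_cast
    have h6 : (1 - 1 / (n : ℝ)) * (R.card * I) ≤ (1 - 1 / (n : ℝ)) * (a' - a) :=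
      mul_le_mul_of_nonneg_left ih (by rw [sub_nonneg, div_le_one hn']; linarith)
    have h7 : (1 / (n : ℝ)) * (R.card * I) ≤ I := by
      rw [one_div, inv_mul_le_iff₀ hn']
      exact mul_le_mul_of_nonneg_right (by linarith) hI0
    linarith

end Playout

/-! ### Truncating the density of a smooth law -/

section Truncation

variable {f : ℝ≥0 → ℝ≥0∞} {u : ℝ} {s : ℝ≥0}

lemma IsGenerator.one_le_of_le_maxSubgradient (hf : IsGenerator f) (hu : 0 < u)
    (hs : (u : EReal) ≤ maxSubgradient f s) : 1 ≤ s := by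
  by_contra! h
  rw [maxSubgradient] at hs
  split_ifs at hs with h1
  · simp at hs
  · have h2 := hs.trans (iInf₂_le (1 : ℝ≥0) h)
    have hpos : (0 : ℝ) < ((1 : ℝ≥0) : ℝ) - (s : ℝ) := sub_pos.2 (by exact_mod_cast h)
    rw [EReal.le_div_iff_mul_le (by exact_mod_cast hpos) (EReal.coe_ne_top _), hf.map_one,
      EReal.coe_ennreal_zero, zero_sub, ← EReal.coe_mul] at h2
    have h3 : -((f s : ℝ≥0∞) : EReal) ≤ 0 := by
      rw [EReal.neg_le_zero]; exact EReal.coe_ennreal_nonneg _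
    have h4 : u * (((1 : ℝ≥0) : ℝ) - (s : ℝ)) ≤ 0 := by exact_mod_cast h2.trans h3
    exact absurd h4 (not_le.2 (mul_pos hu hpos))

lemma IsGenerator.eq_top_of_le (hf : IsGenerator f) (hs : f s = ⊤) (h1 : 1 ≤ s) {r : ℝ≥0}
    (hr : s ≤ r) : f r = ⊤ := by
  rcases hr.eq_or_lt with rfl | hlt
  · exact hs
  by_contra hne
  have hr1 : 0 < r - 1 := tsub_pos_of_lt (h1.trans_lt hlt)
  have hsum : (r - s) / (r - 1) + (s - 1) / (r - 1) = 1 := by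
    rw [← add_div, tsub_add_tsub_cancel hlt.le h1, div_self hr1.ne']
  have hpt : ((r - s) / (r - 1)) • (1 : ℝ≥0) + ((s - 1) / (r - 1)) • r = s := by
    rw [smul_eq_mul, smul_eq_mul, mul_one]
    apply NNReal.eq
    have : (r : ℝ) - 1 ≠ 0 := by
      have : (1 : ℝ) < r := by exact_mod_cast h1.trans_lt hlt
      linarith
    push_cast [NNReal.coe_sub hlt.le, NNReal.coe_sub h1, NNReal.coe_sub (h1.trans hlt.le)]
    field_simp
    ring
  have := hf.convex.2 (Set.mem_univ 1) (Set.mem_univ r) zero_le zero_le hsum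
  rw [hpt, hs, hf.map_one, smul_zero, zero_add, top_le_iff] at this
  exact ENNReal.mul_ne_top ENNReal.coe_ne_top hne this

/-- A generator lies above its tangents of positive slope, shifted down to the axis. -/
lemma IsGenerator.mul_tsub_le (hf : IsGenerator f) (hu : 0 < u)
    (hs : (u : EReal) ≤ maxSubgradient f s) (r : ℝ≥0) :
    ENNReal.ofReal u * ((r - s : ℝ≥0) : ℝ≥0∞) ≤ f r := by
  rcases le_or_gt r s with hr | hr
  · simp [tsub_eq_zero_of_le hr]
  by_cases hfr : f r = ⊤
  · simp [hfr]
  have hfs : f s ≠ ⊤ := fun h =>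
    hfr (hf.eq_top_of_le h (hf.one_le_of_le_maxSubgradient hu hs) hr.le)
  rw [maxSubgradient, if_neg hfs] at hs
  have h2 := hs.trans (iInf₂_le r hr)
  have hpos : (0 : ℝ) < (r : ℝ) - (s : ℝ) := sub_pos.2 (by exact_mod_cast hr)
  rw [EReal.le_div_iff_mul_le (by exact_mod_cast hpos) (EReal.coe_ne_top _)] at h2
  lift f r to ℝ≥0 using hfr with y
  lift f s to ℝ≥0 using hfs with x
  have h3 : u * ((r : ℝ) - s) ≤ y - x := by
    rw [← EReal.coe_mul, EReal.coe_nnreal_eq_coe_real, EReal.coe_nnreal_eq_coe_real,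
      ← EReal.coe_sub] at h2
    exact EReal.coe_le_coe_iff.1 h2
  rw [ENNReal.ofReal, ← ENNReal.coe_mul, ENNReal.coe_le_coe, ← NNReal.coe_le_coe]
  push_cast [NNReal.coe_sub hr.le, Real.coe_toNNReal u hu.le]
  linarith [x.coe_nonneg]

lemma ofReal_le_slopeAtTop (hs : (u : EReal) ≤ maxSubgradient f s) :
    ENNReal.ofReal u ≤ slopeAtTop f := by
  rw [slopeAtTop, ← EReal.real_coe_toENNReal]
  exact EReal.toENNReal_le_toENNReal (hs.trans (le_iSup (maxSubgradient f) s))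

variable {X : Type*} [MeasurableSpace X] {μ ν : Measure X}

/-- All but a mass `ε` of a smooth law has a density at most `s` with respect to `μ`, where `s` is
such that the derivative of the generator at `s` is at least `1 / (ε σ)`: by convexity, the
divergence pays at this rate for the density above `s`. -/
theorem IsSmooth.exists_density [IsProbabilityMeasure μ] [IsProbabilityMeasure ν] {σ ε : ℝ}
    (hf : IsGenerator f) (hσ : 0 < σ) (hε : 0 < ε)
    (hs : ((1 / (ε * σ) : ℝ) : EReal) ≤ maxSubgradient f s) (hν : IsSmooth f σ ν μ) :
    ∃ w : X → ℝ, Measurable w ∧ (∀ z, 0 ≤ w z) ∧ (∀ z, w z ≤ s) ∧ ∫ z, w z ∂μ ≤ 1 ∧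
      ∀ ψ : X → ℝ, Measurable ψ → (∀ z, 0 ≤ ψ z) → (∀ z, ψ z ≤ 1) →
        ∫ z, ψ z ∂ν ≤ ∫ z, w z * ψ z ∂μ + ε := by
  have hu : 0 < 1 / (ε * σ) := by positivity
  set r := ν.rnDeriv μ with hr
  have hrm : Measurable r := Measure.measurable_rnDeriv ν μ
  have hrtop : ∀ᵐ z ∂μ, r z < ⊤ := Measure.rnDeriv_lt_top ν μ
  set w : X → ℝ := fun z => min (r z).toReal s with hw
  have hwm : Measurable w := hrm.ennreal_toReal.min measurable_const
  have hw0 : ∀ z, 0 ≤ w z := fun z => le_min ENNReal.toReal_nonneg s.coe_nonneg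
  have hws : ∀ z, w z ≤ s := fun z => min_le_right _ _
  have hwr : ∀ z, ENNReal.ofReal (w z) ≤ r z := fun z =>
    (ENNReal.ofReal_le_ofReal (min_le_left _ _)).trans ENNReal.ofReal_toReal_le
  have hrint : ∫⁻ z, r z ∂μ ≤ 1 := by
    simpa using Measure.lintegral_rnDeriv_le (μ := ν) (ν := μ)
  have hbad : ∫⁻ z, ((r z).toNNReal - s : ℝ≥0) ∂μ + ν.singularPart μ Set.univ ≤
      ENNReal.ofReal ε := by
    have h1 : ENNReal.ofReal (1 / (ε * σ)) *
        (∫⁻ z, ((r z).toNNReal - s : ℝ≥0) ∂μ + ν.singularPart μ Set.univ) ≤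
        ENNReal.ofReal (1 / (ε * σ)) * ENNReal.ofReal ε := by
      rw [← ENNReal.ofReal_mul hu.le, mul_add,
        ← lintegral_const_mul' _ _ ENNReal.ofReal_ne_top]
      calc _ ≤ fDivergence f ν μ :=
            add_le_add (lintegral_mono fun z => hf.mul_tsub_le hu hs _)
              (mul_le_mul_left (ofReal_le_slopeAtTop hs) _)
        _ ≤ ENNReal.ofReal (1 / σ) := hν
        _ = _ := by congr 1; field_simp
    exact (ENNReal.mul_le_mul_iff_right (by simpa using hu) ENNReal.ofReal_ne_top).1 h1
  refine ⟨w, hwm, hw0, hws, ?_, fun ψ hψ h0 h1 => ?_⟩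
  · rw [integral_eq_lintegral_of_nonneg_ae (ae_of_all _ hw0) hwm.aestronglyMeasurable]
    refine ENNReal.toReal_le_of_le_ofReal zero_le_one ?_
    rw [ENNReal.ofReal_one]
    exact (lintegral_mono hwr).trans hrint
  · have hψw : Integrable (fun z => w z * ψ z) μ := by
      refine Integrable.of_bound (hwm.mul hψ).aestronglyMeasurable s (ae_of_all _ fun z => ?_)
      rw [Real.norm_of_nonneg (mul_nonneg (hw0 z) (h0 z))]
      exact (mul_le_of_le_one_right (hw0 z) (h1 z)).trans (hws z)
    have hψw0 : ∀ z, 0 ≤ w z * ψ z := fun z => mul_nonneg (hw0 z) (h0 z)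
    rw [integral_eq_lintegral_of_nonneg_ae (ae_of_all _ h0) hψ.aestronglyMeasurable]
    refine ENNReal.toReal_le_of_le_ofReal (add_nonneg (integral_nonneg hψw0) hε.le) ?_
    rw [ENNReal.ofReal_add (integral_nonneg hψw0) hε.le,
      ofReal_integral_eq_lintegral_ofReal hψw (ae_of_all _ hψw0)]
    conv_lhs => rw [← Measure.rnDeriv_add_singularPart ν μ]
    rw [lintegral_add_measure, lintegral_withDensity_eq_lintegral_mul _ hrm hψ.ennreal_ofReal]
    have h3 : ∫⁻ z, ENNReal.ofReal (ψ z) ∂(ν.singularPart μ) ≤ ν.singularPart μ Set.univ := by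
      refine (lintegral_mono (g := fun _ => 1) fun z => ?_).trans (by simp)
      simpa using h1 z
    have h4 : ∫⁻ z, (r * fun z => ENNReal.ofReal (ψ z)) z ∂μ ≤
        ∫⁻ z, ENNReal.ofReal (w z * ψ z) ∂μ + ∫⁻ z, ((r z).toNNReal - s : ℝ≥0) ∂μ := by
      rw [← lintegral_add_left (by fun_prop)]
      refine lintegral_mono_ae (hrtop.mono fun z hz => ?_)
      have hrz : r z = ENNReal.ofReal (w z) + ((r z).toNNReal - s : ℝ≥0) := by
        have : ENNReal.ofReal (w z) = (min (r z).toNNReal s : ℝ≥0) := by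
          rw [hw, ENNReal.ofReal]
          simp only [ENNReal.toReal, ← NNReal.coe_min, Real.toNNReal_coe]
        rw [this, ← ENNReal.coe_add, add_comm, tsub_add_min, ENNReal.coe_toNNReal hz.ne]
      rw [Pi.mul_apply, ENNReal.ofReal_mul (hw0 z)]
      conv_lhs => rw [hrz, add_mul]
      refine add_le_add le_rfl (mul_le_of_le_one_right zero_le ?_)
      simpa using h1 z
    calc _ ≤ (∫⁻ z, ENNReal.ofReal (w z * ψ z) ∂μ + ∫⁻ z, ((r z).toNNReal - s : ℝ≥0) ∂μ) +
          ν.singularPart μ Set.univ := add_le_add h4 h3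
      _ ≤ _ := by rw [add_assoc]; exact add_le_add le_rfl hbad

end Truncation

section Domination

variable {X ι : Type*} [MeasurableSpace X] [Fintype ι] [DecidableEq ι] {F : Set (X → Pred)}
  {μ ν : Measure X} [IsProbabilityMeasure μ] [IsProbabilityMeasure ν] {S R : Finset ι}
  {b : (X → Pred) → ℝ} {B : ℝ}

/-- The gain from a perturbation of size one at a point with a smooth law is at most the gain from
`n` fresh hints of size two, up to `ε`. -/
theorem IsSmooth.integral_symmPlayout_le {f : ℝ≥0 → ℝ≥0∞} {σ ε : ℝ} {s : ℝ≥0} {n : ℕ}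
    (hν : IsSmooth f σ ν μ) (hf : IsGenerator f) (hσ : 0 < σ) (hε : 0 < ε)
    (hs : ((1 / (ε * σ) : ℝ) : EReal) ≤ maxSubgradient f s) (hsn : (s : ℝ) ≤ n)
    (hF : HasMeasurableTraces F) (hne : F.Nonempty) (hb : IsTraceFunctional fun _ : Unit => b)
    (hB : ∀ g ∈ F, |b g| ≤ B) (hd : Disjoint S R) (hR : R.card = n) :
    ∫ z, symmPlayout F μ S b 1 z ∂ν ≤ playout F μ (S ∪ R) b + ε := by
  obtain ⟨w, hwm, hw0, hws, hw1, hw⟩ := hν.exists_density hf hσ hε hs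
  have hs1 : (1 : ℝ) ≤ s := by
    exact_mod_cast hf.one_le_of_le_maxSubgradient (by positivity) hs
  have hn : 0 < n := by exact_mod_cast (zero_lt_one.trans_le (hs1.trans hsn) : (0 : ℝ) < n)
  have hn' : (0 : ℝ) < n := by exact_mod_cast hn
  have hm := measurable_symmPlayout (μ := μ) hF hne hb S 1
  have h1 := card_mul_integral_le_playout_union (μ := μ) hF hne hb hB hn (w := fun z => w z / n)
    (hwm.div_const _) (fun z => div_nonneg (hw0 z) hn'.le)
    (fun z => (div_le_one hn').2 ((hws z).trans hsn))
    (by rw [integral_div]; exact div_le_div_of_nonneg_right hw1 hn'.le) hd hR.le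
  rw [hR, ← integral_const_mul] at h1
  have h2 := hw (fun z => symmPlayout F μ S b 1 z - playout F μ S b) (hm.sub_const _)
    (fun z => sub_nonneg.2 (playout_le_symmPlayout hF hne hb hB S 1 z))
    (fun z => sub_le_iff_le_add'.2 (symmPlayout_one_le hF hne hb hB S z))
  have h3 : ∀ z, (n : ℝ) * (w z / n * (symmPlayout F μ S b 1 z - playout F μ S b)) =
      w z * (symmPlayout F μ S b 1 z - playout F μ S b) := fun z => by field_simp
  simp only [h3] at h1
  rw [integral_sub (Integrable.of_bound hm.aestronglyMeasurable _
    (ae_of_all _ fun z => abs_symmPlayout_le hne hB 1 z)) (integrable_const _)] at h2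
  simp only [integral_const, probReal_univ, one_smul] at h2
  linarith

end Domination

/-! ### The learner -/

section Learner

variable {X : Type*} {loss : ℝ → ℝ → ℝ}

/-- An oracle query whose data points are indexed by an arbitrary finite type. -/
noncomputable def ERMQuery.ofFintype {ι : Type*} [Fintype ι] (point : ι → X) (label : ι → Pred)
    (weight : ι → ℝ) (loss : ι → Pred → Pred → ℝ)
    (loss_mem : ∀ i a y, loss i a y ∈ Set.Icc (0 : ℝ) 1)
    (loss_continuous : ∀ i y, Continuous fun a => loss i a y) : ERMQuery X where
  size := Fintype.card ι
  point i := point ((Fintype.equivFin ι).symm i)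
  label i := label ((Fintype.equivFin ι).symm i)
  weight i := weight ((Fintype.equivFin ι).symm i)
  loss i := loss ((Fintype.equivFin ι).symm i)
  loss_mem _ := loss_mem _
  loss_continuous _ := loss_continuous _

lemma ERMQuery.risk_ofFintype {ι : Type*} [Fintype ι] (point : ι → X) (label : ι → Pred)
    (weight : ι → ℝ) (loss : ι → Pred → Pred → ℝ)
    (loss_mem : ∀ i a y, loss i a y ∈ Set.Icc (0 : ℝ) 1)
    (loss_continuous : ∀ i y, Continuous fun a => loss i a y) (g : X → Pred) :
    (ERMQuery.ofFintype point label weight loss loss_mem loss_continuous).risk g =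
      ∑ i, weight i * loss i (g (point i)) (label i) :=
  (Fintype.equivFin ι).symm.sum_comp fun i => weight i * loss i (g (point i)) (label i)

lemma IsConvexLipschitzLoss.continuous (hl : IsConvexLipschitzLoss loss) (y : Pred) :
    Continuous fun a : Pred => loss a y :=
  (hl.lipschitz y y.2).continuousOn.domRestrict

lemma IsConvexLipschitzLoss.abs_sub_le (hl : IsConvexLipschitzLoss loss) (a a' y : Pred) :
    |loss a y - loss a' y| ≤ |(a : ℝ) - a'| := by
  simpa [Real.dist_eq] using (hl.lipschitz y y.2).dist_le_mul a a.2 a' a'.2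

/-- The cumulative loss of `g` on the contexts and labels of a history. -/
def cumLoss (loss : ℝ → ℝ → ℝ) {t : ℕ} (h : History X t) (g : X → Pred) : ℝ :=
  ∑ s, loss (g (h s).1) (h s).2.1

/-- The hints in the rows `t, t + 1, …` of a seed. -/
def hintsFrom (T n t : ℕ) : Finset (Fin T × Fin n) :=
  Finset.univ.filter fun k => t ≤ (k.1 : ℕ)

/-- The objective of the oracle calls in the round after the history `h`: minus the past loss, plus
`c` times the value at the new context `x`, plus twice the Rademacher sum over the hints that stand
for the later rounds. -/
noncomputable def objective (loss : ℝ → ℝ → ℝ) {T n t : ℕ} (h : History X t) (x : X)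
    (ω : Seed X T n) (c : ℝ) (g : X → Pred) : ℝ :=
  (-cumLoss loss h g + c * (g x : ℝ)) +
    2 * ∑ k ∈ hintsFrom T n (t + 1), sign (ω k).2 * (g (ω k).1 : ℝ)

/-- The oracle query that maximizes `objective`. A linear functional of the value at a point is
encoded by the loss `a ↦ (1 + a) / 2` and a signed weight. -/
noncomputable def objectiveQuery (hl : IsConvexLipschitzLoss loss) {T n t : ℕ} (h : History X t)
    (x : X) (ω : Seed X T n) (c : ℝ) : ERMQuery X :=
  ERMQuery.ofFintype (ι := Fin t ⊕ (Fin T × Fin n) ⊕ Unit)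
    (Sum.elim (fun s => (h s).1) (Sum.elim (fun k => (ω k).1) fun _ => x))
    (Sum.elim (fun s => (h s).2.1) fun _ => ⟨0, by norm_num⟩)
    (Sum.elim (fun _ => 1)
      (Sum.elim (fun k => if t + 1 ≤ (k.1 : ℕ) then -4 * sign (ω k).2 else 0) fun _ => -2 * c))
    (Sum.elim (fun _ a y => loss a y) fun _ a _ => (1 + (a : ℝ)) / 2)
    (by
      rintro (s | k) a y
      · exact hl.mem_Icc a a.2 y y.2
      · have := a.2
        simp only [Sum.elim_inr, Set.mem_Icc] at this ⊢
        constructor <;> linarith)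
    (by
      rintro (s | k) y
      · exact hl.continuous y
      · simp only [Sum.elim_inr]; fun_prop)

lemma risk_objectiveQuery (hl : IsConvexLipschitzLoss loss) {T n t : ℕ} (h : History X t) (x : X)
    (ω : Seed X T n) (c : ℝ) (g : X → Pred) :
    (objectiveQuery hl h x ω c).risk g =
      -objective loss h x ω c g - (∑ k ∈ hintsFrom T n (t + 1), 2 * sign (ω k).2 + c) := by
  rw [objectiveQuery, ERMQuery.risk_ofFintype]
  simp only [Fintype.sum_sum_type, Sum.elim_inl, Sum.elim_inr, one_mul, ite_mul, zero_mul,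
    Finset.univ_unique, Finset.sum_singleton, objective, cumLoss, hintsFrom, Finset.sum_filter,
    Finset.mul_sum]
  have : ∀ k : Fin T × Fin n, (if t + 1 ≤ (k.1 : ℕ) then
      -4 * sign (ω k).2 * ((1 + (g (ω k).1 : ℝ)) / 2) else 0) =
      -(2 * if t + 1 ≤ (k.1 : ℕ) then sign (ω k).2 * (g (ω k).1 : ℝ) else 0) -
        (if t + 1 ≤ (k.1 : ℕ) then 2 * sign (ω k).2 else 0) := fun k => by
    split_ifs <;> ring
  simp only [this, Finset.sum_sub_distrib, Finset.sum_neg_distrib]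
  ring

/-- The learner plays half the difference of the maxima of the objective with the two signs of the
value at the new context: this is the prediction that is optimal against the worst of the losses
`a ↦ a` and `a ↦ -a`, when the hints stand in for the future. -/
noncomputable def playoutLearner (hl : IsConvexLipschitzLoss loss) (T n : ℕ) :
    ImproperLearner X (Seed X T n) 2 where
  query _ h x ω l := objectiveQuery hl h x ω (if l.isEmpty then 1 else -1)
  predict _ h x ω l := match l with
    | [g₁, g₂] => Set.projIcc (-1) 1 (by norm_num)
        ((objective loss h x ω 1 g₁ - objective loss h x ω (-1) g₂) / 2)
    | _ => ⟨0, by norm_num⟩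

lemma objective_oracle {F : Set (X → Pred)} {oracle : ERMQuery X → X → Pred}
    (ho : IsERMOracle F oracle) (hl : IsConvexLipschitzLoss loss) {T n t : ℕ} (h : History X t)
    (x : X) (ω : Seed X T n) (c : ℝ) :
    objective loss h x ω c (oracle (objectiveQuery hl h x ω c)) =
      perturbedSup F (hintsFrom T n (t + 1)) ω fun g => -cumLoss loss h g + c * (g x : ℝ) := by
  obtain ⟨hmem, hmin⟩ := ho (objectiveQuery hl h x ω c)
  have hle : ∀ g ∈ F, objective loss h x ω c g ≤
      objective loss h x ω c (oracle (objectiveQuery hl h x ω c)) := fun g hg => by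
    have := hmin g hg
    rw [risk_objectiveQuery, risk_objectiveQuery] at this
    linarith
  have : Nonempty F := ⟨⟨_, hmem⟩⟩
  exact le_antisymm (le_ciSup (f := fun g : F => objective loss h x ω c g)
    ⟨_, by rintro _ ⟨g, rfl⟩; exact hle g g.2⟩ ⟨_, hmem⟩) (ciSup_le fun g => hle g g.2)

lemma play_playoutLearner {F : Set (X → Pred)} {oracle : ERMQuery X → X → Pred}
    (ho : IsERMOracle F oracle) (hl : IsConvexLipschitzLoss loss) {T n t : ℕ} (h : History X t)
    (x : X) (ω : Seed X T n) :
    (playoutLearner hl T n).play oracle t h x ω = Set.projIcc (-1) 1 (by norm_num)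
      ((perturbedSup F (hintsFrom T n (t + 1)) ω (fun g => -cumLoss loss h g + 1 * (g x : ℝ)) -
        perturbedSup F (hintsFrom T n (t + 1)) ω
          (fun g => -cumLoss loss h g - 1 * (g x : ℝ))) / 2) := by
  have h1 := objective_oracle ho hl h x ω 1
  have h2 := objective_oracle ho hl h x ω (-1)
  simp only [neg_mul, ← sub_eq_add_neg] at h2
  rw [← h1, ← h2]
  rfl

/-- The value of the two-sided prediction: whatever the label, a `1`-Lipschitz loss `d₀` at the
prediction, compared to the losses `d i` of the competitors, is paid for by a random sign. -/
lemma add_iSup_le_symmetrized {I : Type*} [Nonempty I] {u c d : I → ℝ} {B d₀ : ℝ} {p : Pred}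
    (hu : ∀ i, |u i| ≤ B) (hc : ∀ i, |c i| ≤ 1)
    (hp : p = Set.projIcc (-1) 1 (by norm_num) (((⨆ i, (u i + c i)) - ⨆ i, (u i - c i)) / 2))
    (hd : ∀ i, |d₀ - d i| ≤ |(p : ℝ) - c i|) :
    d₀ + ⨆ i, (u i - d i) ≤ ((⨆ i, (u i + c i)) + ⨆ i, (u i - c i)) / 2 := by
  have b1 := bddAbove_range_of_abs_le fun i => abs_add_le_of_le (hu i) (hc i)
  have b2 := bddAbove_range_of_abs_le fun i => abs_sub_le_of_le (hu i) (hc i)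
  have e1 : ⨆ i, (u i + c i) ≤ (⨆ i, (u i - c i)) + 2 := ciSup_le fun i => by
    have := le_ciSup b2 i
    have := abs_le.1 (hc i)
    linarith
  have e2 : ⨆ i, (u i - c i) ≤ (⨆ i, (u i + c i)) + 2 := ciSup_le fun i => by
    have := le_ciSup b1 i
    have := abs_le.1 (hc i)
    linarith
  have hpv : (p : ℝ) = ((⨆ i, (u i + c i)) - ⨆ i, (u i - c i)) / 2 := by
    rw [hp, Set.projIcc_of_mem]
    constructor <;> linarith
  rw [← le_sub_iff_add_le']
  refine ciSup_le fun i => ?_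
  have h1 := le_ciSup b1 i
  have h2 := le_ciSup b2 i
  have h3 := (le_abs_self _).trans (hd i)
  rcases le_total (c i) p with h | h
  · rw [abs_of_nonneg (sub_nonneg.2 h)] at h3
    linarith
  · rw [abs_of_nonpos (sub_nonpos.2 h)] at h3
    linarith

lemma abs_cumLoss_le (hl : IsConvexLipschitzLoss loss) {t : ℕ} (h : History X t) (g : X → Pred) :
    |cumLoss loss h g| ≤ t := by
  refine (Finset.abs_sum_le_sum_abs _ _).trans ?_
  have := Finset.sum_le_card_nsmul Finset.univ
    (fun s => |loss (g (h s).1) (h s).2.1|) 1 fun s _ => by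
      have := hl.mem_Icc _ (g (h s).1).2 _ (h s).2.1.2
      exact abs_le.2 ⟨by linarith [this.1], this.2⟩
  simpa using this

lemma cumLoss_nonneg (hl : IsConvexLipschitzLoss loss) {t : ℕ} (h : History X t) (g : X → Pred) :
    0 ≤ cumLoss loss h g :=
  Finset.sum_nonneg fun s _ => (hl.mem_Icc _ (g (h s).1).2 _ (h s).2.1.2).1

lemma cumLoss_snoc {t : ℕ} (h : History X t) (q : X × Pred × Pred) (g : X → Pred) :
    cumLoss loss (Fin.snoc h q : History X (t + 1)) g = cumLoss loss h g + loss (g q.1) q.2.1 := by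
  simp [cumLoss, Fin.sum_univ_castSucc]

variable [MeasurableSpace X]

lemma isTraceFunctional_loss (hl : IsConvexLipschitzLoss loss) {P : Type*} [MeasurableSpace P]
    {x : P → X} {y : P → Pred} (hx : Measurable x) (hy : Measurable y) :
    IsTraceFunctional fun p (g : X → Pred) => loss (g (x p)) (y p) :=
  IsTraceFunctional.eval hx (Φ := fun p (a : Pred) => loss a (y p))
    (fun _ => hl.measurable.comp (measurable_const.prodMk hy)) fun p => hl.continuous (y p)

lemma isTraceFunctional_cumLoss (hl : IsConvexLipschitzLoss loss) (t : ℕ) :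
    IsTraceFunctional fun (h : History X t) g => cumLoss loss h g :=
  IsTraceFunctional.sum Finset.univ fun s _ =>
    isTraceFunctional_loss hl (x := fun h : History X t => (h s).1) (y := fun h => (h s).2.1)
      (by fun_prop) (by fun_prop)

lemma isTraceFunctional_neg_cumLoss_const (hl : IsConvexLipschitzLoss loss) {t : ℕ}
    (h : History X t) : IsTraceFunctional fun (_ : Unit) g => -cumLoss loss h g :=
  (isTraceFunctional_cumLoss hl t).neg.comp (u := fun _ : Unit => h) measurable_const

lemma isMeasurable_playoutLearner {F : Set (X → Pred)} {oracle : ERMQuery X → X → Pred}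
    (ho : IsERMOracle F oracle) (hF : HasMeasurableTraces F) (hne : F.Nonempty)
    (hl : IsConvexLipschitzLoss loss) (T n : ℕ) :
    (playoutLearner hl T n).IsMeasurable oracle T := by
  intro t _
  simp only [play_playoutLearner ho hl]
  have hL : IsTraceFunctional fun (p : History X t × X) g => -cumLoss loss p.1 g :=
    (isTraceFunctional_cumLoss hl t).neg.comp measurable_fst
  have he := isTraceFunctional_mul_eval (X := X) 1 (measurable_snd (α := History X t))
  have h1 := measurable_perturbedSup hF hne (hL.add he) (hintsFrom T n (t + 1))
  have h2 := measurable_perturbedSup hF hne (hL.sub he) (hintsFrom T n (t + 1))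
  exact continuous_projIcc.measurable.comp ((h1.sub h2).div_const 2)

end Learner

/-! ### The potential along the game -/

section Game

variable {X : Type*} {loss : ℝ → ℝ → ℝ}

/-- The cumulative loss of the learner. -/
def learnerLoss (loss : ℝ → ℝ → ℝ) {t : ℕ} (h : History X t) : ℝ :=
  ∑ s, loss (h s).2.2 (h s).2.1

lemma learnerLoss_snoc {t : ℕ} (h : History X t) (q : X × Pred × Pred) :
    learnerLoss loss (Fin.snoc h q : History X (t + 1)) =
      learnerLoss loss h + loss q.2.2 q.2.1 := by
  simp [learnerLoss, Fin.sum_univ_castSucc]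

lemma abs_learnerLoss_le (hl : IsConvexLipschitzLoss loss) {t : ℕ} (h : History X t) :
    |learnerLoss loss h| ≤ t := by
  refine (Finset.abs_sum_le_sum_abs _ _).trans ?_
  have := Finset.sum_le_card_nsmul Finset.univ
    (fun s => |loss (h s).2.2 (h s).2.1|) 1 fun s _ => by
      have := hl.mem_Icc _ (h s).2.2.2 _ (h s).2.1.2
      exact abs_le.2 ⟨by linarith [this.1], this.2⟩
  simpa using this

variable {F : Set (X → Pred)}

lemma regret_eq {T : ℕ} (h : History X T) :
    regret loss F h = learnerLoss loss h + ⨆ g : F, -cumLoss loss h g := by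
  have h1 := Real.mul_iInf_of_nonpos (show (-1 : ℝ) ≤ 0 by norm_num) fun g : F => cumLoss loss h g
  simp only [neg_mul, one_mul] at h1
  rw [← h1, ← sub_eq_add_neg]
  rfl

lemma regret_le (hl : IsConvexLipschitzLoss loss) {T : ℕ} (h : History X T) :
    regret loss F h ≤ T := by
  have h1 := (abs_le.1 (abs_learnerLoss_le hl h)).2
  have h2 : 0 ≤ ⨅ g : F, cumLoss loss h g := Real.iInf_nonneg fun g => cumLoss_nonneg hl h g
  have : regret loss F h = learnerLoss loss h - ⨅ g : F, cumLoss loss h g := rfl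
  linarith

lemma hintsFrom_zero (T n : ℕ) : hintsFrom T n 0 = Finset.univ := by simp [hintsFrom]

lemma hintsFrom_self (T n : ℕ) : hintsFrom T n T = ∅ := by
  ext k; simp [hintsFrom]

lemma hintsFrom_eq_union {T n t : ℕ} (ht : t < T) :
    hintsFrom T n t = hintsFrom T n (t + 1) ∪ {(⟨t, ht⟩ : Fin T)} ×ˢ Finset.univ := by
  ext ⟨i, j⟩
  simp only [hintsFrom, Finset.mem_filter, Finset.mem_univ, true_and, Finset.mem_union,
    Finset.mem_product, Finset.mem_singleton, Fin.ext_iff, and_true]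
  omega

lemma disjoint_hintsFrom_row {T n t : ℕ} (ht : t < T) :
    Disjoint (hintsFrom T n (t + 1)) ({(⟨t, ht⟩ : Fin T)} ×ˢ (Finset.univ : Finset (Fin n))) := by
  rw [Finset.disjoint_left]
  rintro ⟨i, j⟩
  simp only [hintsFrom, Finset.mem_filter, Finset.mem_univ, true_and,
    Finset.mem_product, Finset.mem_singleton, Fin.ext_iff, and_true]
  omega

variable [MeasurableSpace X] {μ : Measure X} [IsProbabilityMeasure μ]

/-- The potential after the history `h`: the learner's loss plus the expected supremum of minus the
loss of the competitor plus twice the Rademacher sum over the hints for the remaining rounds. -/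
noncomputable def potential (loss : ℝ → ℝ → ℝ) (F : Set (X → Pred)) (μ : Measure X) (T n : ℕ) {t : ℕ}
    (h : History X t) : ℝ :=
  learnerLoss loss h + playout F μ (hintsFrom T n t) fun g => -cumLoss loss h g

lemma measurable_learnerLoss (hl : IsConvexLipschitzLoss loss) (t : ℕ) :
    Measurable fun h : History X t => learnerLoss loss h :=
  Finset.measurable_sum _ fun s _ =>
    hl.measurable.comp (f := fun h : History X t => ((h s).2.2, (h s).2.1)) (by fun_prop)

lemma measurable_potential (hl : IsConvexLipschitzLoss loss) (hF : HasMeasurableTraces F)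
    (hne : F.Nonempty) (T n t : ℕ) :
    Measurable fun h : History X t => potential loss F μ T n h :=
  (measurable_learnerLoss hl t).add
    (measurable_playout hF hne (isTraceFunctional_cumLoss hl t).neg _)

lemma abs_potential_le (hl : IsConvexLipschitzLoss loss)
    (hne : F.Nonempty) {T n t : ℕ} (h : History X t) :
    |potential loss F μ T n h| ≤ t + (t + 2 * (hintsFrom T n t).card) :=
  abs_add_le_of_le (abs_learnerLoss_le hl h)
    (abs_playout_le hne fun g _ => by rw [abs_neg]; exact abs_cumLoss_le hl h g)

lemma potential_final {T n : ℕ} (h : History X T) :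
    potential loss F μ T n h = regret loss F h := by
  simp [potential, hintsFrom_self, playout, perturbedSup, regret_eq]

lemma ImproperLearner.IsMeasurable.measurable_play {S : Type*} [MeasurableSpace S] {k : ℕ}
    {A : ImproperLearner X S k} {oracle : ERMQuery X → X → Pred} {T t : ℕ}
    (hA : A.IsMeasurable oracle T) (ht : t < T) (h : History X t) (x : X) :
    Measurable fun s => A.play oracle t h x s :=
  (hA t ht).comp (f := fun s => ((h, x), s)) (by fun_prop)

/-- In expectation over the seed, the learner's loss in one round and the new potential are at most
the old loss plus the supremum symmetrized at the new context. -/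
lemma integral_potential_snoc_le {oracle : ERMQuery X → X → Pred} (ho : IsERMOracle F oracle)
    (hl : IsConvexLipschitzLoss loss) (hF : HasMeasurableTraces F) (hne : F.Nonempty) {T n t : ℕ}
    (ht : t < T) (h : History X t) (x : X) (y : Pred) :
    ∫ ω, potential loss F μ T n (Fin.snoc h (x, y, (playoutLearner hl T n).play oracle t h x ω) :
        History X (t + 1)) ∂(seedLaw μ T n) ≤
      learnerLoss loss h +
        symmPlayout F μ (hintsFrom T n (t + 1)) (fun g => -cumLoss loss h g) 1 x := by
  have : Nonempty F := hne.to_subtype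
  have hρ : seedLaw μ T n = Measure.pi fun _ : Fin T × Fin n => hintLaw μ := rfl
  have hplay : Measurable fun ω => (playoutLearner hl T n).play oracle t h x ω :=
    (isMeasurable_playoutLearner ho hF hne hl T n).measurable_play ht h x
  have hℓm : Measurable fun ω => loss ((playoutLearner hl T n).play oracle t h x ω) y :=
    hl.measurable.comp (hplay.prodMk measurable_const)
  have hℓi : Integrable (fun ω => loss ((playoutLearner hl T n).play oracle t h x ω) y)
      (Measure.pi fun _ : Fin T × Fin n => hintLaw μ) := by
    refine Integrable.of_bound hℓm.aestronglyMeasurable 1 (ae_of_all _ fun ω => ?_)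
    have := hl.mem_Icc _ ((playoutLearner hl T n).play oracle t h x ω).2 _ y.2
    exact abs_le.2 ⟨by linarith [this.1], this.2⟩
  set S := hintsFrom T n (t + 1)
  have hb := isTraceFunctional_neg_cumLoss_const hl h
  have hB : ∀ g ∈ F, |-cumLoss loss h g| ≤ t := fun g _ => by
    rw [abs_neg]; exact abs_cumLoss_le hl h g
  have hb' : IsTraceFunctional fun (_ : Unit) g => -cumLoss loss h g - loss (g x) y :=
    hb.sub (isTraceFunctional_loss hl (x := fun _ => x) (y := fun _ => y)
      measurable_const measurable_const)
  have hB' : ∀ g ∈ F, |-cumLoss loss h g - loss (g x) y| ≤ t + 1 := fun g hg =>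
    abs_sub_le_of_le (hB g hg) (by
      have := hl.mem_Icc _ (g x).2 _ y.2
      exact abs_le.2 ⟨by linarith [this.1], this.2⟩)
  have hi' := integrable_perturbedSup (μ := μ) hF hne hb' hB' S
  have hsplit : ∀ ω, potential loss F μ T n
      (Fin.snoc h (x, y, (playoutLearner hl T n).play oracle t h x ω) : History X (t + 1)) =
      (learnerLoss loss h + playout F μ S fun g => -cumLoss loss h g - loss (g x) y) +
        loss ((playoutLearner hl T n).play oracle t h x ω) y := fun ω => by
    simp only [potential, learnerLoss_snoc, cumLoss_snoc, neg_add, ← sub_eq_add_neg]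
    rw [add_right_comm]
  simp only [hsplit]
  rw [hρ, integral_add (integrable_const _) hℓi, integral_const, probReal_univ, one_smul,
    add_assoc, symmPlayout_eq_integral hF hne hb hB, playout, ← integral_add hi' hℓi]
  refine add_le_add le_rfl ?_
  refine integral_mono (hi'.add hℓi) (integrable_perturbedSup_symm hF hne hb hB S 1 x)
    fun ω => ?_
  have key := add_iSup_le_symmetrized (I := F)
    (u := fun g => -cumLoss loss h g + 2 * ∑ k ∈ S, sign (ω k).2 * ((g : X → Pred) (ω k).1 : ℝ))
    (c := fun g => ((g : X → Pred) x : ℝ)) (d := fun g => loss ((g : X → Pred) x) y)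
    (d₀ := loss ((playoutLearner hl T n).play oracle t h x ω) y)
    (p := (playoutLearner hl T n).play oracle t h x ω)
    (fun g => abs_add_le_of_le (hB g g.2) (abs_hintSum_le S ω g))
    (fun g => abs_le.2 ((g : X → Pred) x).2)
    (by
      rw [play_playoutLearner ho hl]
      simp only [perturbedSup, one_mul, add_right_comm, add_sub_right_comm]
      rfl)
    (fun g => hl.abs_sub_le _ _ _)
  rw [add_comm] at key
  simpa only [perturbedSup, one_mul, add_right_comm, add_sub_right_comm] using key

variable {oracle : ERMQuery X → X → Pred} {adv : Adversary X}

lemma isProbabilityMeasure_seedLaw (T n : ℕ) : IsProbabilityMeasure (seedLaw μ T n) :=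
  inferInstanceAs (IsProbabilityMeasure (Measure.pi fun _ : Fin T × Fin n => hintLaw μ))

lemma measurable_nextHistory {S : Type*} [MeasurableSpace S] {k : ℕ}
    {A : ImproperLearner X S k} {T t : ℕ} (hA : A.IsMeasurable oracle T) (ht : t < T) :
    Measurable fun p : (History X t × X × Pred) × S =>
      (Fin.snoc p.1.1 (p.1.2.1, p.1.2.2, A.play oracle t p.1.1 p.1.2.1 p.2) :
        History X (t + 1)) := by
  have hp : Measurable fun p : (History X t × X × Pred) × S =>
      A.play oracle t p.1.1 p.1.2.1 p.2 :=
    (hA t ht).comp (f := fun p : (History X t × X × Pred) × S => ((p.1.1, p.1.2.1), p.2))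
      (by fun_prop)
  refine measurable_pi_lambda _ fun i => ?_
  refine Fin.lastCases ?_ (fun j => ?_) i
  · simp only [Fin.snoc_last]
    exact measurable_fst.snd.fst.prodMk (measurable_fst.snd.snd.prodMk hp)
  · simp only [Fin.snoc_castSucc]
    exact (measurable_pi_apply j).comp measurable_fst.fst

lemma isProbabilityMeasure_gameLaw {S : Type*} [MeasurableSpace S] {k : ℕ}
    {A : ImproperLearner X S k} {ρ : Measure S} [IsProbabilityMeasure ρ] {T : ℕ} (hA : A.IsMeasurable oracle T) :
    ∀ t ≤ T, IsProbabilityMeasure (gameLaw A oracle ρ adv t) := by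
  intro t
  induction t with
  | zero => intro _; exact Measure.dirac.isProbabilityMeasure
  | succ t ih =>
    intro ht
    have := ih (by omega)
    have := adv.isMarkov t
    exact Measure.isProbabilityMeasure_map (measurable_nextHistory hA (by omega)).aemeasurable

/-- If in each round the symmetrization at the new context costs at most the hints of this round and
`ε`, the potential increases by at most `ε` in expectation. -/
lemma integral_potential_succ_le (ho : IsERMOracle F oracle)
    (hl : IsConvexLipschitzLoss loss) (hF : HasMeasurableTraces F) (hne : F.Nonempty) {T n t : ℕ}
    {ε : ℝ} (ht : t < T)
    (hround : ∀ h : History X t,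
      ∫ z, symmPlayout F μ (hintsFrom T n (t + 1)) (fun g => -cumLoss loss h g) 1 z
        ∂((adv.draw t h).map Prod.fst) ≤
      playout F μ (hintsFrom T n t) (fun g => -cumLoss loss h g) + ε) :
    ∫ h, potential loss F μ T n h
        ∂(gameLaw (playoutLearner hl T n) oracle (seedLaw μ T n) adv (t + 1)) ≤
      ∫ h, potential loss F μ T n h
        ∂(gameLaw (playoutLearner hl T n) oracle (seedLaw μ T n) adv t) + ε := by
  have hA := isMeasurable_playoutLearner ho hF hne hl T n
  have := isProbabilityMeasure_seedLaw (μ := μ) T n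
  have := isProbabilityMeasure_gameLaw (ρ := seedLaw μ T n) (adv := adv) hA t ht.le
  have := adv.isMarkov t
  have hb : IsTraceFunctional fun (p : History X t × X × Pred) g => -cumLoss loss p.1 g :=
    (isTraceFunctional_cumLoss hl t).neg.comp measurable_fst
  have he := isTraceFunctional_mul_eval (X := X) 1
    (measurable_fst.comp (measurable_snd (α := History X t) (β := X × Pred)))
  have hB : ∀ (h : History X t), ∀ g ∈ F, |-cumLoss loss h g| ≤ t := fun h g _ => by
    rw [abs_neg]; exact abs_cumLoss_le hl h g
  set S := hintsFrom T n (t + 1)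
  -- the intermediate quantity, in which the prediction has been replaced by a symmetrization
  set G : History X t × X × Pred → ℝ := fun p =>
    learnerLoss loss p.1 + symmPlayout F μ S (fun g => -cumLoss loss p.1 g) 1 p.2.1 with hG
  have hGm : Measurable G :=
    ((measurable_learnerLoss hl t).comp measurable_fst).add
      (((measurable_playout hF hne (hb.add he) S).add
        (measurable_playout hF hne (hb.sub he) S)).div_const 2)
  have hGb : ∀ p, |G p| ≤ t + (t + |1| + 2 * S.card) := fun p =>
    abs_add_le_of_le (abs_learnerLoss_le hl p.1) (abs_symmPlayout_le hne (hB p.1) 1 p.2.1)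
  have hGi : Integrable G
      ((gameLaw (playoutLearner hl T n) oracle (seedLaw μ T n) adv t).compProd (adv.draw t)) :=
    Integrable.of_bound hGm.aestronglyMeasurable _ (ae_of_all _ hGb)
  have hpot := measurable_potential (μ := μ) hl hF hne T n (t + 1)
  have hnext := measurable_nextHistory hA ht
  have hi : Integrable (fun p : (History X t × X × Pred) × Seed X T n =>
      potential loss F μ T n (Fin.snoc p.1.1 (p.1.2.1, p.1.2.2,
        (playoutLearner hl T n).play oracle t p.1.1 p.1.2.1 p.2) : History X (t + 1)))
      (((gameLaw (playoutLearner hl T n) oracle (seedLaw μ T n) adv t).compProd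
        (adv.draw t)).prod (seedLaw μ T n)) :=
    Integrable.of_bound (hpot.comp hnext).aestronglyMeasurable _
      (ae_of_all _ fun p => abs_potential_le hl hne _)
  have hpt : Integrable (fun h => potential loss F μ T n h)
      (gameLaw (playoutLearner hl T n) oracle (seedLaw μ T n) adv t) :=
    Integrable.of_bound (measurable_potential hl hF hne T n t).aestronglyMeasurable _
      (ae_of_all _ fun p => abs_potential_le hl hne _)
  calc _ = ∫ p, ∫ ω, potential loss F μ T n (Fin.snoc p.1 (p.2.1, p.2.2,
            (playoutLearner hl T n).play oracle t p.1 p.2.1 ω) : History X (t + 1))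
            ∂(seedLaw μ T n)
          ∂((gameLaw (playoutLearner hl T n) oracle (seedLaw μ T n) adv t).compProd
            (adv.draw t)) := by
        rw [gameLaw, integral_map hnext.aemeasurable hpot.aestronglyMeasurable, integral_prod _ hi]
    _ ≤ ∫ p, G p ∂((gameLaw (playoutLearner hl T n) oracle (seedLaw μ T n) adv t).compProd
            (adv.draw t)) :=
        integral_mono hi.integral_prod_left hGi fun p =>
          integral_potential_snoc_le ho hl hF hne ht p.1 p.2.1 p.2.2
    _ = ∫ h, ∫ q, G (h, q) ∂(adv.draw t h)
          ∂(gameLaw (playoutLearner hl T n) oracle (seedLaw μ T n) adv t) :=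
        Measure.integral_compProd hGi
    _ ≤ ∫ h, (potential loss F μ T n h + ε)
          ∂(gameLaw (playoutLearner hl T n) oracle (seedLaw μ T n) adv t) := by
        refine integral_mono hGi.integral_compProd (hpt.add (integrable_const ε)) fun h => ?_
        have hm := measurable_symmPlayout (μ := μ) hF hne
          (isTraceFunctional_neg_cumLoss_const hl h) S 1
        have hround := hround h
        rw [integral_map measurable_fst.aemeasurable hm.aestronglyMeasurable] at hround
        have hsi : Integrable (fun q : X × Pred =>
            symmPlayout F μ S (fun g => -cumLoss loss h g) 1 q.1) (adv.draw t h) :=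
          Integrable.of_bound (hm.comp measurable_fst).aestronglyMeasurable _
            (ae_of_all _ fun q => abs_symmPlayout_le hne (hB h) 1 q.1)
        simp only [hG]
        rw [integral_add (integrable_const _) hsi, integral_const, probReal_univ, one_smul]
        simp only [potential]
        linarith
    _ = _ := by rw [integral_add hpt (integrable_const ε)]; simp

/-- The regret of the learner is at most the initial potential plus the errors of the rounds. -/
theorem integral_regret_le (ho : IsERMOracle F oracle)
    (hl : IsConvexLipschitzLoss loss) (hF : HasMeasurableTraces F) (hne : F.Nonempty) {T n : ℕ}
    {ε : ℝ}
    (hround : ∀ t < T, ∀ h : History X t,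
      ∫ z, symmPlayout F μ (hintsFrom T n (t + 1)) (fun g => -cumLoss loss h g) 1 z
        ∂((adv.draw t h).map Prod.fst) ≤
      playout F μ (hintsFrom T n t) (fun g => -cumLoss loss h g) + ε) :
    ∫ h, regret loss F h ∂(gameLaw (playoutLearner hl T n) oracle (seedLaw μ T n) adv T) ≤
      playout F μ (Finset.univ : Finset (Fin T × Fin n)) (fun _ => 0) + ε * T := by
  have main : ∀ t ≤ T, ∫ h, potential loss F μ T n h
      ∂(gameLaw (playoutLearner hl T n) oracle (seedLaw μ T n) adv t) ≤
        playout F μ (Finset.univ : Finset (Fin T × Fin n)) (fun _ => 0) + ε * t := by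
    intro t
    induction t with
    | zero =>
      intro _
      rw [gameLaw, integral_dirac' _ _
        (measurable_potential hl hF hne T n 0).stronglyMeasurable]
      simp [potential, learnerLoss, cumLoss, hintsFrom_zero]
    | succ t ih =>
      intro ht
      have h1 := ih (by omega)
      have h2 := integral_potential_succ_le (adv := adv) ho hl hF hne ht (hround t ht)
      push_cast
      linarith
  simpa only [potential_final] using main T le_rfl

/-- The regret is bounded and measurable. -/
lemma integrable_regret (ho : IsERMOracle F oracle)
    (hl : IsConvexLipschitzLoss loss) (hF : HasMeasurableTraces F) (hne : F.Nonempty) (T n : ℕ) :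
    Integrable (regret loss F)
      (gameLaw (playoutLearner hl T n) oracle (seedLaw μ T n) adv T) := by
  have := isProbabilityMeasure_seedLaw (μ := μ) T n
  have := isProbabilityMeasure_gameLaw (ρ := seedLaw μ T n) (adv := adv)
    (isMeasurable_playoutLearner ho hF hne hl T n) T le_rfl
  have h := Integrable.of_bound (measurable_potential (μ := μ) hl hF hne T n T).aestronglyMeasurable
    _ (ae_of_all (gameLaw (playoutLearner hl T n) oracle (seedLaw μ T n) adv T)
      fun p => abs_potential_le hl hne _)
  simpa only [potential_final] using h

end Game

/-! ### The initial potential and the Rademacher complexity -/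

section Rademacher

variable {X : Type*}

lemma integral_pi_fairCoin {N : ℕ} (u : (Fin N → Bool) → ℝ) :
    ∫ e, u e ∂(Measure.pi fun _ => (PMF.uniformOfFintype Bool).toMeasure) =
      (∑ e, u e) / 2 ^ N := by
  rw [integral_fintype .of_finite, Finset.sum_div]
  refine Finset.sum_congr rfl fun e _ => ?_
  have : (Measure.pi fun _ : Fin N => (PMF.uniformOfFintype Bool).toMeasure) {e} =
      (2 : ℝ≥0∞)⁻¹ ^ N := by
    rw [Measure.pi_singleton]
    simp
  rw [measureReal_def, this]
  simp
  ring

lemma playout_univ_zero [MeasurableSpace X] {F : Set (X → Pred)} {μ : Measure X}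
    [IsProbabilityMeasure μ] {ι : Type*} [Fintype ι] (hF : HasMeasurableTraces F)
    (hne : F.Nonempty) {N : ℕ} (hN : Fintype.card ι = N) :
    playout F μ (Finset.univ : Finset ι) (fun _ => 0) = 2 * expectedRademacher F μ N := by
  let e : Fin N ≃ ι := (Fintype.equivFinOfCardEq hN).symm
  have hi : ∀ κ : Type _, ∀ _ : Fintype κ,
      Integrable (fun ω : κ → X × Bool => perturbedSup F Finset.univ ω fun _ => 0)
        (Measure.pi fun _ : κ => hintLaw μ) := fun κ _ =>
    integrable_perturbedSup (B := 0) hF hne IsTraceFunctional.zero (by simp) _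
  have h1 := measurePreserving_piCongrLeft (fun _ : ι => hintLaw μ) e
  have h2 := (measurePreserving_arrowProdEquivProdArrow X Bool (Fin N) (fun _ => μ)
    fun _ => (PMF.uniformOfFintype Bool).toMeasure).symm
  have hre : ∀ ω : Fin N → X × Bool,
      perturbedSup F Finset.univ (MeasurableEquiv.piCongrLeft (fun _ : ι => X × Bool) e ω)
        (fun _ => 0) = perturbedSup F Finset.univ ω fun _ => 0 := fun ω => by
    simp only [perturbedSup]
    congr 1; ext g
    rw [← e.sum_comp]
    simp only [MeasurableEquiv.piCongrLeft_apply_apply (β := fun _ : ι => X × Bool)]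
  have h3 : playout F μ (Finset.univ : Finset ι) (fun _ => 0) =
      playout F μ (Finset.univ : Finset (Fin N)) fun _ => 0 := by
    rw [playout, ← h1.integral_comp']
    simp only [hre]
    rfl
  have h4 : ∀ (z : Fin N → X) (c : Fin N → Bool), perturbedSup F Finset.univ
      ((MeasurableEquiv.arrowProdEquivProdArrow X Bool (Fin N)).symm (z, c)) (fun _ => 0) =
      2 * ⨆ g : F, ∑ i, sign (c i) * ((g : X → Pred) (z i) : ℝ) := fun z c => by
    rw [Real.mul_iSup_of_nonneg zero_le_two]
    simp only [perturbedSup, zero_add]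
    rfl
  have hi2 : Integrable (fun q => perturbedSup F Finset.univ
      ((MeasurableEquiv.arrowProdEquivProdArrow X Bool (Fin N)).symm q) fun _ => 0)
      ((Measure.pi fun _ => μ).prod
        (Measure.pi fun _ => (PMF.uniformOfFintype Bool).toMeasure)) :=
    h2.integrable_comp_of_integrable (hi _ _)
  rw [h3, playout]
  unfold hintLaw
  rw [← h2.integral_comp', integral_prod _ hi2]
  simp only [h4, integral_const_mul, integral_pi_fairCoin]
  rfl

/-- **Massart's finite class lemma** for a binary class with the sign patterns `𝒜` on `z`, by
exponential moments. Instead of Jensen's inequality for the logarithm, its tangent at the bound for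
the mean is used. For `N = 0` the complexity is zero, and the exponential moments only give `L`. -/
lemma rademacher_le_sqrt {F : Set (X → Pred)} (hne : F.Nonempty) {N : ℕ} {z : Fin N → X}
    {𝒜 : Finset (Finset (Fin N))} {L : ℝ}
    (h : ∀ g ∈ F, ∃ A ∈ 𝒜, ∀ i, (g (z i) : ℝ) = if i ∈ A then 1 else -1)
    (hL : (𝒜.card : ℝ) ≤ Real.exp L) (hN : N = 0 → L = 0) :
    rademacher F z ≤ √(2 * N * L) := by
  classical
  have : Nonempty F := hne.to_subtype
  obtain ⟨g₀, hg₀⟩ := hne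
  obtain ⟨A₀, hA₀, -⟩ := h g₀ hg₀
  set v : Finset (Fin N) → Fin N → ℝ := fun A i => if i ∈ A then 1 else -1 with hv
  have key : ∀ l : ℝ, 0 < l → l * rademacher F z ≤ L + l ^ 2 * N / 2 := by
    intro l hl
    set E : (Fin N → Bool) → ℝ := fun ε => ∑ A ∈ 𝒜, Real.exp (l * ∑ i, sign (ε i) * v A i) with hE
    have hEpos : ∀ ε, 0 < E ε := fun ε => Finset.sum_pos (fun _ _ => Real.exp_pos _) ⟨A₀, hA₀⟩
    have hsup : ∀ ε : Fin N → Bool,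
        l * ⨆ g : F, ∑ i, sign (ε i) * ((g : X → Pred) (z i) : ℝ) ≤ Real.log (E ε) := fun ε => by
      rw [Real.mul_iSup_of_nonneg hl.le]
      refine ciSup_le fun g => ?_
      obtain ⟨A, hA, hgA⟩ := h g g.2
      rw [Real.le_log_iff_exp_le (hEpos ε)]
      simp only [hgA]
      exact Finset.single_le_sum (f := fun A => Real.exp (l * ∑ i, sign (ε i) * v A i))
        (fun _ _ => (Real.exp_pos _).le) hA
    have hmean : ∀ A, ∑ ε : Fin N → Bool, Real.exp (l * ∑ i, sign (ε i) * v A i) ≤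
        2 ^ N * Real.exp (l ^ 2 * N / 2) := fun A => by
      have h1 : ∀ ε : Fin N → Bool, Real.exp (l * ∑ i, sign (ε i) * v A i) =
          ∏ i, Real.exp (l * (sign (ε i) * v A i)) := fun ε => by
        rw [Finset.mul_sum, Real.exp_sum]
      have h2 : ∏ i : Fin N, ∑ e : Bool, Real.exp (l * (sign e * v A i)) =
          ∑ ε : Fin N → Bool, ∏ i, Real.exp (l * (sign (ε i) * v A i)) := by
        rw [Finset.prod_univ_sum, Fintype.piFinset_univ]
      have h3 : ∀ i : Fin N, ∑ e : Bool, Real.exp (l * (sign e * v A i)) = 2 * Real.cosh l := by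
        intro i
        rw [Real.cosh_eq]
        by_cases hi : i ∈ A
        · simp [sign, hv, hi]; ring
        · simp [sign, hv, hi]; ring
      simp only [h1]
      rw [← h2]
      simp only [h3, Finset.prod_const, Finset.card_univ, Fintype.card_fin, mul_pow]
      refine mul_le_mul_of_nonneg_left ?_ (by positivity)
      calc Real.cosh l ^ N ≤ Real.exp (l ^ 2 / 2) ^ N :=
            pow_le_pow_left₀ (Real.cosh_pos l).le (Real.cosh_le_exp_half_sq l) N
        _ = _ := by rw [← Real.exp_nat_mul]; congr 1; ring
    set c := Real.exp (L + l ^ 2 * N / 2) with hc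
    have hEsum : ∑ ε, E ε ≤ 2 ^ N * c := by
      rw [hE, Finset.sum_comm]
      calc _ ≤ ∑ _A ∈ 𝒜, (2 : ℝ) ^ N * Real.exp (l ^ 2 * N / 2) :=
            Finset.sum_le_sum fun A _ => hmean A
        _ = 2 ^ N * (𝒜.card * Real.exp (l ^ 2 * N / 2)) := by
            rw [Finset.sum_const, nsmul_eq_mul]; ring
        _ ≤ _ := by
            rw [hc, Real.exp_add]
            gcongr
    have hlog : ∀ ε, Real.log (E ε) ≤ E ε / c - 1 + (L + l ^ 2 * N / 2) := fun ε => by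
      have h1 := Real.log_le_sub_one_of_pos (div_pos (hEpos ε) (Real.exp_pos (L + l ^ 2 * N / 2)))
      rw [Real.log_div (hEpos ε).ne' (Real.exp_pos _).ne', Real.log_exp] at h1
      linarith
    have h2N : (0 : ℝ) < 2 ^ N := by positivity
    rw [rademacher, mul_div_assoc', div_le_iff₀ h2N, Finset.mul_sum]
    calc _ ≤ ∑ ε, (E ε / c - 1 + (L + l ^ 2 * N / 2)) :=
          Finset.sum_le_sum fun ε _ => (hsup ε).trans (hlog ε)
      _ = (∑ ε, E ε) / c - 2 ^ N + (L + l ^ 2 * N / 2) * 2 ^ N := by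
          rw [Finset.sum_add_distrib, Finset.sum_sub_distrib, ← Finset.sum_div]
          simp only [Finset.sum_const, Finset.card_univ, Fintype.card_fun, Fintype.card_bool,
            Fintype.card_fin, nsmul_eq_mul]
          push_cast
          ring
      _ ≤ _ := by
          have : (∑ ε, E ε) / c ≤ 2 ^ N := (div_le_iff₀ (Real.exp_pos _)).2 hEsum
          linarith
  by_contra! hlt
  have hR : 0 < rademacher F z := (Real.sqrt_nonneg _).trans_lt hlt
  have hR2 : 2 * N * L < rademacher F z ^ 2 := Real.lt_sq_of_sqrt_lt hlt
  rcases Nat.eq_zero_or_pos N with h0 | h0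
  · have := key 1 one_pos
    have hN0 : (N : ℝ) = 0 := by exact_mod_cast h0
    simp only [hN h0, hN0, mul_zero, zero_div, add_zero, one_mul] at this
    linarith
  · have hN0 : (0 : ℝ) < N := by exact_mod_cast h0
    -- this value of `l` maximizes `l * R - l ^ 2 * N / 2`, where `R` is the complexity
    have h1 := key (rademacher F z / N) (by positivity)
    have h2 : rademacher F z / N * rademacher F z = rademacher F z ^ 2 / N := by ring
    have h3 : (rademacher F z / N) ^ 2 * N / 2 = rademacher F z ^ 2 / N / 2 := by
      field_simp
    rw [h2, h3] at h1
    have h4 : rademacher F z ^ 2 / N ≤ 2 * L := by linarith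
    rw [div_le_iff₀ hN0] at h4
    linarith

end Rademacher

/-! ### Binary classes of finite VC dimension -/

section VC

variable {X : Type*} {F : Set (X → Pred)} {d : ℕ}

lemma sum_choose_le_pow (N d : ℕ) : ∑ k ∈ Finset.Iic d, N.choose k ≤ (N + 1) ^ d := by
  rw [add_pow, Nat.range_succ_eq_Iic]
  refine Finset.sum_le_sum fun k hk => ?_
  simp only [one_pow, mul_one]
  exact (Nat.choose_le_pow N k).trans
    (Nat.le_mul_of_pos_right _ (Nat.choose_pos (Finset.mem_Iic.1 hk)))

lemma Shatters.card_le (hd : vcDim F = d) {A : Finset X} (hA : Shatters F A) : A.card ≤ d := by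
  have : (A.card : ℕ∞) ≤ vcDim F := le_iSup₂ (f := fun (A : Finset X) (_ : Shatters F A) =>
    (A.card : ℕ∞)) A hA
  rw [hd] at this
  exact_mod_cast this

/-- By the Sauer-Shelah lemma a binary class has polynomially many sign patterns on `N` points. A
point that is repeated is no obstacle: `z` is injective on a shattered set of indices. -/
lemma exists_card_le_pow_signPatterns (hbin : IsBinary F) (hd : vcDim F = d) {N : ℕ}
    (z : Fin N → X) : ∃ 𝒜 : Finset (Finset (Fin N)), 𝒜.card ≤ (N + 1) ^ d ∧
      ∀ g ∈ F, ∃ A ∈ 𝒜, ∀ i, (g (z i) : ℝ) = if i ∈ A then 1 else -1 := by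
  classical
  set 𝒜 : Finset (Finset (Fin N)) :=
    Finset.univ.filter fun A => ∃ g ∈ F, ∀ i, (g (z i) : ℝ) = 1 ↔ i ∈ A with h𝒜
  refine ⟨𝒜, ?_, fun g hg => ⟨Finset.univ.filter fun i => (g (z i) : ℝ) = 1, ?_, fun i => ?_⟩⟩
  · have hvc : 𝒜.vcDim ≤ d := by
      refine Finset.sup_le fun s hs => ?_
      rw [Finset.mem_shatterer] at hs
      have hinj : Set.InjOn z s := by
        intro i hi j hj hij
        by_contra hne
        obtain ⟨u, hu, hsu⟩ := hs (Finset.singleton_subset_iff.2 hi)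
        obtain ⟨g, -, hgu⟩ := (Finset.mem_filter.1 hu).2
        have h1 : i ∈ s ∩ u := by rw [hsu]; exact Finset.mem_singleton_self i
        have h2 := (hgu i).2 (Finset.mem_inter.1 h1).2
        rw [hij] at h2
        have h3 : j ∈ s ∩ u := Finset.mem_inter.2 ⟨hj, (hgu j).1 h2⟩
        rw [hsu, Finset.mem_singleton] at h3
        exact hne h3.symm
      rw [← Finset.card_image_of_injOn hinj]
      refine Shatters.card_le hd fun B => ?_
      obtain ⟨u, hu, hsu⟩ := hs (Finset.filter_subset (fun i => z i ∈ B) s)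
      obtain ⟨g, hg, hgu⟩ := (Finset.mem_filter.1 hu).2
      refine ⟨g, hg, fun x hx => ?_⟩
      obtain ⟨i, hi, rfl⟩ := Finset.mem_image.1 hx
      have := Finset.ext_iff.1 hsu i
      rw [Finset.mem_inter, Finset.mem_filter] at this
      rw [hgu i]
      tauto
    calc 𝒜.card ≤ 𝒜.shatterer.card := 𝒜.card_le_card_shatterer
      _ ≤ ∑ k ∈ Finset.Iic 𝒜.vcDim, N.choose k := by
        simpa using Finset.card_shatterer_le_sum_vcDim (𝒜 := 𝒜)
      _ ≤ (N + 1) ^ 𝒜.vcDim := sum_choose_le_pow _ _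
      _ ≤ (N + 1) ^ d := Nat.pow_le_pow_right (by omega) hvc
  · rw [h𝒜, Finset.mem_filter]
    exact ⟨Finset.mem_univ _, g, hg, fun i => by simp⟩
  · rcases hbin g hg (z i) with h | h <;> simp [h]

lemma rademacher_le_of_vcDim (hbin : IsBinary F) (hd : vcDim F = d) (hne : F.Nonempty) {N : ℕ}
    (z : Fin N → X) : rademacher F z ≤ √(2 * N * (d * Real.log (N + 1))) := by
  obtain ⟨𝒜, hcard, h⟩ := exists_card_le_pow_signPatterns hbin hd z
  have hN : (0 : ℝ) < (N : ℝ) + 1 := by positivity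
  refine rademacher_le_sqrt hne h ?_ (by rintro rfl; simp)
  rw [Real.exp_nat_mul, Real.exp_log hN]
  exact_mod_cast hcard

lemma expectedRademacher_le_of_vcDim [MeasurableSpace X] {μ : Measure X} [IsProbabilityMeasure μ]
    (hbin : IsBinary F) (hd : vcDim F = d) (hne : F.Nonempty) (N : ℕ) :
    expectedRademacher F μ N ≤ √(2 * N * (d * Real.log (N + 1))) := by
  rw [expectedRademacher]
  by_cases hi : Integrable (fun z : Fin N → X => rademacher F z) (Measure.pi fun _ => μ)
  · refine (integral_mono hi (integrable_const _)
      fun z => rademacher_le_of_vcDim hbin hd hne z).trans ?_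
    simp
  · rw [integral_undef hi]
    exact Real.sqrt_nonneg _

/-- A binary class of VC dimension zero has a single element. -/
lemma subsingleton_of_vcDim_zero (hbin : IsBinary F) (hd : vcDim F = 0) : F.Subsingleton := by
  have key : ∀ g ∈ F, ∀ g' ∈ F, ∀ x, (g x : ℝ) = 1 → (g' x : ℝ) = 1 := by
    intro g hg g' hg' x h1
    by_contra h2
    have : Shatters F {x} := fun B => by
      by_cases hx : x ∈ B
      · exact ⟨g, hg, fun y hy => by rw [Finset.mem_singleton.1 hy]; simp [h1, hx]⟩
      · exact ⟨g', hg', fun y hy => by rw [Finset.mem_singleton.1 hy]; simp [h2, hx]⟩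
    simpa using this.card_le (d := 0) (by simpa using hd)
  intro g hg g' hg'
  funext x
  apply Subtype.ext
  rcases hbin g hg x with h | h
  · rw [h, key g hg g' hg' x h]
  · rcases hbin g' hg' x with h' | h'
    · exact (key g' hg' g hg x h').trans h'.symm
    · rw [h, h']

end VC

/-! ### Regret bounds -/

section Regret

variable {X : Type*} [MeasurableSpace X] {loss : ℝ → ℝ → ℝ} {F : Set (X → Pred)}
  {μ : Measure X} [IsProbabilityMeasure μ] {oracle : ERMQuery X → X → Pred} {adv : Adversary X}

lemma IsERMOracle.nonempty {X : Type*} {F : Set (X → Pred)}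
    {oracle : ERMQuery X → X → Pred} (ho : IsERMOracle F oracle) : F.Nonempty :=
  ⟨_, (ho (ERMQuery.ofFintype (ι := Empty) Empty.elim Empty.elim Empty.elim
    (fun i => i.elim) (fun i => i.elim) fun i => i.elim)).1⟩

/-- If `n` is at least a point where the derivative of the generator exceeds `1 / (ε σ)`, the regret
is at most twice the Rademacher complexity of `n T` samples plus `ε T`. -/
theorem integral_regret_le_of_smooth {f : ℝ≥0 → ℝ≥0∞} {σ ε : ℝ} {s : ℝ≥0} {T n : ℕ}
    (ho : IsERMOracle F oracle) (hl : IsConvexLipschitzLoss loss) (hF : HasMeasurableTraces F)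
    (hne : F.Nonempty) (hadv : adv.IsSmooth f σ μ T) (hf : IsGenerator f) (hσ : 0 < σ)
    (hε : 0 < ε) (hs : ((1 / (ε * σ) : ℝ) : EReal) ≤ maxSubgradient f s) (hsn : (s : ℝ) ≤ n) :
    ∫ h, regret loss F h ∂(gameLaw (playoutLearner hl T n) oracle (seedLaw μ T n) adv T) ≤
      2 * expectedRademacher F μ (n * T) + ε * T := by
  rw [← playout_univ_zero (ι := Fin T × Fin n) hF hne (by simp [mul_comm])]
  refine integral_regret_le ho hl hF hne fun t ht h => ?_
  have := adv.isMarkov t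
  have : IsProbabilityMeasure ((adv.draw t h).map Prod.fst) :=
    Measure.isProbabilityMeasure_map measurable_fst.aemeasurable
  rw [hintsFrom_eq_union ht]
  exact (hadv t ht h).integral_symmPlayout_le hf hσ hε hs hsn hF hne
    (isTraceFunctional_neg_cumLoss_const hl h)
    (fun g _ => by rw [abs_neg]; exact abs_cumLoss_le hl h g) (disjoint_hintsFrom_row ht)
    (by simp)

/-- Against a class with a single element the learner has no regret, even without hints. -/
lemma integral_regret_nonpos_of_subsingleton (ho : IsERMOracle F oracle)
    (hl : IsConvexLipschitzLoss loss) (hF : HasMeasurableTraces F) (hne : F.Nonempty)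
    (hsub : F.Subsingleton) (T : ℕ) :
    ∫ h, regret loss F h ∂(gameLaw (playoutLearner hl T 0) oracle (seedLaw μ T 0) adv T) ≤ 0 := by
  obtain ⟨g₀, rfl⟩ := Set.exists_eq_singleton_iff_nonempty_subsingleton.2 ⟨hne, hsub⟩
  have h0 : playout {g₀} μ (Finset.univ : Finset (Fin T × Fin 0)) (fun _ => 0) = 0 := by
    simp [playout, perturbedSup]
  have := integral_regret_le (T := T) (n := 0) (ε := 0) (μ := μ) (adv := adv) ho hl hF hne
    fun t ht h => by
      have := adv.isMarkov t
      have : IsProbabilityMeasure ((adv.draw t h).map Prod.fst) :=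
        Measure.isProbabilityMeasure_map measurable_fst.aemeasurable
      have hS : ∀ S : Finset (Fin T × Fin 0), S = ∅ := fun S => Finset.eq_empty_of_isEmpty S
      have : ∀ z, symmPlayout {g₀} μ (hintsFrom T 0 (t + 1)) (fun g => -cumLoss loss h g) 1 z =
          playout {g₀} μ (hintsFrom T 0 t) fun g => -cumLoss loss h g := fun z => by
        rw [hS (hintsFrom T 0 (t + 1)), hS (hintsFrom T 0 t)]
        simp [symmPlayout, playout, perturbedSup]
      simp [this]
  rw [h0] at this
  simpa using this

lemma integral_regret_le_rounds (ho : IsERMOracle F oracle) (hl : IsConvexLipschitzLoss loss)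
    (hF : HasMeasurableTraces F) (hne : F.Nonempty) (T n : ℕ) :
    ∫ h, regret loss F h ∂(gameLaw (playoutLearner hl T n) oracle (seedLaw μ T n) adv T) ≤ T := by
  have := isProbabilityMeasure_seedLaw (μ := μ) T n
  have := isProbabilityMeasure_gameLaw (ρ := seedLaw μ T n) (adv := adv)
    (isMeasurable_playoutLearner ho hF hne hl T n) T le_rfl
  refine (integral_mono (integrable_regret ho hl hF hne T n) (integrable_const (T : ℝ))
    fun h => regret_le hl h).trans ?_
  simp

lemma expectedRademacher_nonneg (hF : HasMeasurableTraces F) (hne : F.Nonempty) (N : ℕ) :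
    0 ≤ expectedRademacher F μ N := by
  have : Nonempty F := hne.to_subtype
  have h0 : playout F μ (∅ : Finset (Fin N)) (fun _ => 0) = 0 := by simp [playout, perturbedSup]
  have h1 := playout_mono (μ := μ) (B := 0) hF hne IsTraceFunctional.zero (by simp)
    (Finset.empty_subset (Finset.univ : Finset (Fin N)))
  rw [h0, playout_univ_zero hF hne (Fintype.card_fin N)] at h1
  linarith

end Regret

/-! ### The number of samples per round -/

section Choice

variable {f : ℝ≥0 → ℝ≥0∞} {u : ℝ}

lemma exists_lt_of_derivInv_lt {c : ℝ≥0∞} (h : derivInv f u < c) :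
    ∃ s : ℝ≥0, (u : EReal) ≤ maxSubgradient f s ∧ (s : ℝ≥0∞) < c := by
  simp only [derivInv, iInf_lt_iff] at h
  obtain ⟨s, ⟨_, hs⟩, hlt⟩ := h
  exact ⟨s, hs, hlt⟩

lemma IsGenerator.one_le_derivInv (hf : IsGenerator f) (hu : 0 < u) : 1 ≤ derivInv f u :=
  le_iInf₂ fun _ hs => by exact_mod_cast hf.one_le_of_le_maxSubgradient hu hs.2

/-- The real number `8 log T` is larger than `1` for `T ≥ 2`, which leaves room to replace the
infimum `derivInv` by a point where the derivative is large. -/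
lemma IsGenerator.exists_le_of_mul_derivInv_le (hf : IsGenerator f) (hu : 0 < u) {T n : ℕ}
    (hT : 2 ≤ T) (h : ENNReal.ofReal (8 * Real.log T) * derivInv f u ≤ n) :
    ∃ s : ℝ≥0, (u : EReal) ≤ maxSubgradient f s ∧ (s : ℝ) ≤ n := by
  have hlog : (1 : ℝ) < 8 * Real.log T := by
    have h1 := Real.log_two_gt_d9
    have h2 : Real.log 2 ≤ Real.log T :=
      Real.log_le_log two_pos (by exact_mod_cast hT)
    linarith
  have hM1 := hf.one_le_derivInv hu
  have hMtop : derivInv f u ≠ ⊤ := fun htop => by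
    rw [htop, ENNReal.mul_top (by simpa using zero_lt_one.trans hlog)] at h
    simp at h
  have hlt : derivInv f u < n := by
    refine lt_of_lt_of_le ?_ h
    calc derivInv f u = 1 * derivInv f u := (one_mul _).symm
      _ < _ := by
        refine ENNReal.mul_lt_mul_left (zero_lt_one.trans_le hM1).ne' hMtop ?_
        rwa [← ENNReal.ofReal_one, ENNReal.ofReal_lt_ofReal_iff (by linarith)]
  obtain ⟨s, hs, hsn⟩ := exists_lt_of_derivInv_lt hlt
  have hsn : s < (n : ℝ≥0) := by exact_mod_cast hsn
  exact ⟨s, hs, by exact_mod_cast hsn.le⟩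

/-- If the target bound `√(d T log T m)` is below `T`, then `3 m T` samples are polynomially many
in `T`, and the logarithm of the number of sign patterns is of order `d log T`. -/
lemma sqrt_vcBound_le {T d n : ℕ} {m : ℝ} (hT : 2 ≤ T) (hd : 1 ≤ d) (hm : 1 ≤ m)
    (hn : (n : ℝ) ≤ 3 * m) (hlt : √(d * T * Real.log T * m) < T) :
    √(2 * (n * T : ℕ) * (d * Real.log ((n * T : ℕ) + 1))) ≤ 6 * √(d * T * Real.log T * m) := by
  have hT' : (2 : ℝ) ≤ T := by exact_mod_cast hT
  have hd' : (1 : ℝ) ≤ d := by exact_mod_cast hd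
  have hlog2 : (1 / 2 : ℝ) < Real.log T := by
    have h1 := Real.log_two_gt_d9
    have h2 : Real.log 2 ≤ Real.log T := Real.log_le_log two_pos hT'
    linarith
  have hsq : d * T * Real.log T * m < (T : ℝ) ^ 2 := by
    rw [Real.sqrt_lt' (by linarith)] at hlt
    exact hlt
  have hmT : m ≤ 2 * T := by
    have h1 : (T : ℝ) * (Real.log T * m) ≤ d * T * Real.log T * m := by
      have : 0 ≤ T * (Real.log T * m) := by positivity
      nlinarith
    have h2 : (T : ℝ) * (Real.log T * m) < T * T := by linarith [sq (T : ℝ)]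
    have h3 := lt_of_mul_lt_mul_left h2 (by linarith)
    nlinarith
  have hN : ((n * T : ℕ) : ℝ) + 1 ≤ (T : ℝ) ^ 5 := by
    push_cast
    have h1 : (n : ℝ) * T ≤ 6 * T * T := mul_le_mul_of_nonneg_right (by linarith) (by linarith)
    have h2 : (8 : ℝ) ≤ T ^ 3 := by
      calc (8 : ℝ) = 2 ^ 3 := by norm_num
        _ ≤ _ := pow_le_pow_left₀ (by norm_num) hT' 3
    have h3 : (8 : ℝ) * T ^ 2 ≤ T ^ 3 * T ^ 2 := mul_le_mul_of_nonneg_right h2 (by positivity)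
    nlinarith
  have hlogN : Real.log ((n * T : ℕ) + 1) ≤ 5 * Real.log T := by
    calc _ ≤ Real.log ((T : ℝ) ^ 5) := Real.log_le_log (by positivity) hN
      _ = _ := by rw [Real.log_pow]; norm_num
  have h36 : 6 * √(d * T * Real.log T * m) = √(36 * (d * T * Real.log T * m)) := by
    rw [Real.sqrt_mul (by norm_num : (0 : ℝ) ≤ 36), show (36 : ℝ) = 6 ^ 2 by norm_num,
      Real.sqrt_sq (by norm_num)]
  rw [h36]
  refine Real.sqrt_le_sqrt ?_
  calc _ ≤ 2 * (3 * m * T) * (d * (5 * Real.log T)) := by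
        have h0 : 0 ≤ Real.log ((n * T : ℕ) + 1) :=
          Real.log_nonneg (by linarith [((n * T).cast_nonneg : (0 : ℝ) ≤ (n * T : ℕ))])
        push_cast at h0 hlogN ⊢
        gcongr
    _ = 30 * (d * T * Real.log T * m) := by ring
    _ ≤ _ := by
        have : 0 ≤ d * T * Real.log T * m := by positivity
        linarith

end Choice

/-- The bound of the theorem for binary classes, as a function of the parameter `α`. -/
noncomputable def binaryBound (f : ℝ≥0 → ℝ≥0∞) (σ : ℝ) (T d : ℕ) (α : ℝ) : ℝ≥0∞ :=
  ENNReal.ofReal (α * T) +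
    (ENNReal.ofReal (d * T * Real.log T) * derivInv f (1 / (α * σ))) ^ (1 / 2 : ℝ)

/-- Whenever the bound is below the trivial one, the number of samples per round can be chosen so
that the Rademacher bound is of the right order. -/
lemma exists_samples_of_binaryBound_lt {f : ℝ≥0 → ℝ≥0∞} (hf : IsGenerator f) {σ α : ℝ} {T d : ℕ}
    (hσ : 0 < σ) (hα : 0 < α) (hT : 2 ≤ T) (hd : 1 ≤ d) (hlt : binaryBound f σ T d α < T) :
    ∃ (n : ℕ) (s : ℝ≥0), ((1 / (α * σ) : ℝ) : EReal) ≤ maxSubgradient f s ∧ (s : ℝ) ≤ n ∧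
      ENNReal.ofReal (2 * √(2 * (n * T : ℕ) * (d * Real.log ((n * T : ℕ) + 1))) + α * T) ≤
        12 * binaryBound f σ T d α := by
  have hu : 0 < 1 / (α * σ) := by positivity
  have hT' : (2 : ℝ) ≤ T := by exact_mod_cast hT
  have hd' : (1 : ℝ) ≤ d := by exact_mod_cast hd
  have hlog : 0 < Real.log T := Real.log_pos (by linarith)
  have hM1 := hf.one_le_derivInv hu
  have hq : 0 < d * T * Real.log T := by positivity
  have hMtop : derivInv f (1 / (α * σ)) ≠ ⊤ := fun htop => by
    rw [binaryBound, htop, ENNReal.mul_top (by simpa using hq),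
      ENNReal.top_rpow_of_pos (by norm_num)] at hlt
    simp at hlt
  have h2M : derivInv f (1 / (α * σ)) < 2 * derivInv f (1 / (α * σ)) := by
    rw [two_mul]
    exact ENNReal.lt_add_right hMtop (zero_lt_one.trans_le hM1).ne'
  obtain ⟨s, hs, hsM⟩ := exists_lt_of_derivInv_lt h2M
  set m := (derivInv f (1 / (α * σ))).toReal with hm
  have hMm : derivInv f (1 / (α * σ)) = ENNReal.ofReal m := (ENNReal.ofReal_toReal hMtop).symm
  have hm1 : 1 ≤ m := by
    rw [hMm] at hM1
    simpa using hM1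
  have hsm : (s : ℝ) < 2 * m := by
    rw [hMm, ← ENNReal.ofReal_ofNat, ← ENNReal.ofReal_mul (by norm_num)] at hsM
    have := ENNReal.toReal_strict_mono ENNReal.ofReal_ne_top hsM
    rwa [ENNReal.toReal_ofReal (by linarith), ENNReal.coe_toReal] at this
  have hbound : binaryBound f σ T d α = ENNReal.ofReal (α * T + √(d * T * Real.log T * m)) := by
    rw [binaryBound, hMm, ← ENNReal.ofReal_mul hq.le,
      ENNReal.ofReal_rpow_of_nonneg (by positivity) (by norm_num), ← Real.sqrt_eq_rpow,
      ← ENNReal.ofReal_add (by positivity) (by positivity)]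
  refine ⟨⌈(s : ℝ)⌉₊, s, hs, Nat.le_ceil _, ?_⟩
  have hn : ((⌈(s : ℝ)⌉₊ : ℕ) : ℝ) ≤ 3 * m := by
    linarith [(Nat.ceil_lt_add_one s.coe_nonneg)]
  have hlt' : √(d * T * Real.log T * m) < T := by
    rw [hbound, ← ENNReal.ofReal_natCast, ENNReal.ofReal_lt_ofReal_iff (by linarith)] at hlt
    have : 0 < α * T := by positivity
    linarith
  have h1 := sqrt_vcBound_le hT hd hm1 hn hlt'
  rw [hbound, ← ENNReal.ofReal_ofNat, ← ENNReal.ofReal_mul (by norm_num)]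
  refine ENNReal.ofReal_le_ofReal ?_
  have : 0 < α * T := by positivity
  linarith

lemma le_binaryBound {f : ℝ≥0 → ℝ≥0∞} (hf : IsGenerator f) {σ α : ℝ} {T d : ℕ}
    (hσ : 0 < σ) (hα : 0 < α) :
    ENNReal.ofReal (d * T * Real.log T) ^ (1 / 2 : ℝ) ≤ binaryBound f σ T d α := by
  refine le_trans ?_ le_add_self
  refine ENNReal.rpow_le_rpow ?_ (by norm_num)
  exact le_mul_of_one_le_right zero_le (hf.one_le_derivInv (by positivity))

end SmoothedOnline

open SmoothedOnline
theorem theorem5 :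
    -- binary classes
    (∃ C : ℝ≥0, ∀ (X : Type*) [MeasurableSpace X] (loss : ℝ → ℝ → ℝ) (T d : ℕ)
        (f : ℝ≥0 → ℝ≥0∞) (σ : ℝ),
      IsConvexLipschitzLoss loss → 2 ≤ T → IsGenerator f → 0 < σ →
      ∃ (n : ℕ) (A : ImproperLearner X (Seed X T n) 2),
        ∀ (μ : Measure X) [IsProbabilityMeasure μ] (F : Set (X → Pred))
          (oracle : ERMQuery X → X → Pred) (adv : Adversary X),
          IsBinary F → vcDim F = d → HasMeasurableTraces F → IsERMOracle F oracle →
          adv.IsSmooth f σ μ T →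
          A.IsMeasurable oracle T ∧
          Integrable (regret loss F) (gameLaw A oracle (seedLaw μ T n) adv T) ∧
          ENNReal.ofReal (∫ h, regret loss F h ∂(gameLaw A oracle (seedLaw μ T n) adv T)) ≤
            C * ⨅ α : ℝ, ⨅ _ : 0 < α,
              (ENNReal.ofReal (α * T) +
                (ENNReal.ofReal (d * T * Real.log T) * derivInv f (1 / (α * σ))) ^ (1 / 2 : ℝ))) ∧
    -- real-valued classes
    (∀ (X : Type*) [MeasurableSpace X] (loss : ℝ → ℝ → ℝ) (T n : ℕ),
      IsConvexLipschitzLoss loss →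
      ∃ A : ImproperLearner X (Seed X T n) 2,
        ∀ (μ : Measure X) [IsProbabilityMeasure μ] (f : ℝ≥0 → ℝ≥0∞) (σ ε : ℝ)
          (F : Set (X → Pred)) (oracle : ERMQuery X → X → Pred) (adv : Adversary X),
          IsGenerator f → 0 < σ → 0 < ε →
          ENNReal.ofReal (8 * Real.log T) * derivInv f (1 / (ε * σ)) ≤ n →
          HasMeasurableTraces F → IsERMOracle F oracle → adv.IsSmooth f σ μ T →
          A.IsMeasurable oracle T ∧
          Integrable (regret loss F) (gameLaw A oracle (seedLaw μ T n) adv T) ∧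
          ∫ h, regret loss F h ∂(gameLaw A oracle (seedLaw μ T n) adv T) ≤
            2 * expectedRademacher F μ (n * T) + ε * T + 1) := by
  constructor
  · refine ⟨24, fun X _ loss T d f σ hl hT hf hσ => ?_⟩
    change ∃ (n : ℕ) (A : ImproperLearner X (Seed X T n) 2),
        ∀ (μ : Measure X) [IsProbabilityMeasure μ] (F : Set (X → Pred))
          (oracle : ERMQuery X → X → Pred) (adv : Adversary X),
          IsBinary F → vcDim F = d → HasMeasurableTraces F → IsERMOracle F oracle →
          adv.IsSmooth f σ μ T →
          A.IsMeasurable oracle T ∧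
          Integrable (regret loss F) (gameLaw A oracle (seedLaw μ T n) adv T) ∧
          ENNReal.ofReal (∫ h, regret loss F h ∂(gameLaw A oracle (seedLaw μ T n) adv T)) ≤
            (24 : ℝ≥0) * ⨅ α : ℝ, ⨅ _ : 0 < α, binaryBound f σ T d α
    set I : ℝ≥0∞ := ⨅ α : ℝ, ⨅ _ : 0 < α, binaryBound f σ T d α with hI
    rcases Nat.eq_zero_or_pos d with rfl | hd
    · -- Here the bound is zero: `0 * derivInv f u` vanishes even if `derivInv f u` is infinite,
      -- and `α` is arbitrarily small. So is the regret, for no hints are needed.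
      refine ⟨0, playoutLearner hl T 0, fun μ _ F oracle adv hbin hvc hF ho _ => ?_⟩
      have hne := ho.nonempty
      refine ⟨isMeasurable_playoutLearner ho hF hne hl T 0, integrable_regret ho hl hF hne T 0, ?_⟩
      rw [ENNReal.ofReal_of_nonpos (integral_regret_nonpos_of_subsingleton ho hl hF hne
        (subsingleton_of_vcDim_zero hbin (by simpa using hvc)) T)]
      exact zero_le
    · have hIpos : I ≠ 0 := by
        have hq : 0 < d * T * Real.log T := by
          have : 0 < Real.log T := Real.log_pos (by exact_mod_cast hT)
          have : (0 : ℝ) < d := by exact_mod_cast hd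
          have : (0 : ℝ) < T := by exact_mod_cast (by omega : 0 < T)
          positivity
        have : ENNReal.ofReal (d * T * Real.log T) ^ (1 / 2 : ℝ) ≤ I :=
          le_iInf₂ fun α hα => le_binaryBound hf hσ hα
        refine (lt_of_lt_of_le ?_ this).ne'
        exact ENNReal.rpow_pos (by simpa using hq) ENNReal.ofReal_ne_top
      rcases le_or_gt (T : ℝ≥0∞) I with hIT | hIT
      · refine ⟨0, playoutLearner hl T 0, fun μ _ F oracle adv hbin hvc hF ho _ => ?_⟩
        have hne := ho.nonempty
        refine ⟨isMeasurable_playoutLearner ho hF hne hl T 0,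
          integrable_regret ho hl hF hne T 0, ?_⟩
        calc _ ≤ ENNReal.ofReal T :=
              ENNReal.ofReal_le_ofReal (integral_regret_le_rounds ho hl hF hne T 0)
          _ ≤ 1 * I := by rw [one_mul, ENNReal.ofReal_natCast]; exact hIT
          _ ≤ _ := mul_le_mul_left (by norm_num) _
      · have hlt : I < min (2 * I) T := by
          refine lt_min ?_ hIT
          rw [two_mul]
          exact ENNReal.lt_add_right (hIT.trans_le le_top).ne hIpos
        obtain ⟨α, hα, hαlt⟩ : ∃ α : ℝ, ∃ _ : 0 < α, binaryBound f σ T d α < min (2 * I) T := by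
          rw [hI] at hlt
          simpa only [iInf_lt_iff] using hlt
        obtain ⟨n, s, hs, hsn, hbound⟩ := exists_samples_of_binaryBound_lt hf hσ hα hT hd
          (hαlt.trans_le (min_le_right _ _))
        refine ⟨n, playoutLearner hl T n, fun μ _ F oracle adv hbin hvc hF ho hadv => ?_⟩
        have hne := ho.nonempty
        refine ⟨isMeasurable_playoutLearner ho hF hne hl T n,
          integrable_regret ho hl hF hne T n, ?_⟩
        have h1 := integral_regret_le_of_smooth ho hl hF hne hadv hf hσ hα hs hsn
        have h2 := expectedRademacher_le_of_vcDim (μ := μ) hbin hvc hne (n * T)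
        calc _ ≤ ENNReal.ofReal (2 * √(2 * (n * T : ℕ) * (d * Real.log ((n * T : ℕ) + 1))) +
                α * T) := ENNReal.ofReal_le_ofReal (by linarith)
          _ ≤ 12 * binaryBound f σ T d α := hbound
          _ ≤ 12 * (2 * I) := by
              gcongr
              exact (hαlt.trans_le (min_le_left _ _)).le
          _ = _ := by rw [← mul_assoc]; norm_num
  · intro X _ loss T n hl
    refine ⟨playoutLearner hl T n, fun μ _ f σ ε F oracle adv hf hσ hε hn hF ho hadv => ?_⟩
    have hne := ho.nonempty
    refine ⟨isMeasurable_playoutLearner ho hF hne hl T n, integrable_regret ho hl hF hne T n, ?_⟩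
    rcases lt_or_ge T 2 with hT | hT
    · have h1 := integral_regret_le_rounds (μ := μ) (adv := adv) ho hl hF hne T n
      have h2 := expectedRademacher_nonneg (μ := μ) hF hne (n * T)
      have h3 : (T : ℝ) ≤ 1 := by exact_mod_cast (by omega : T ≤ 1)
      have h4 : 0 ≤ ε * T := by positivity
      linarith
    · obtain ⟨s, hs, hsn⟩ := hf.exists_le_of_mul_derivInv_le (by positivity) hT hn
      have := integral_regret_le_of_smooth ho hl hF hne hadv hf hσ hε hs hsn
      linarith
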